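/- Let $m>0$ and let $(\mathcal M,g)$ be the Schwarzschild--Kruskal spacetime of mass $m$, that is, $$\mathcal M=\{(T,X,\omega)\in\mathbb R\times\mathbb R\times S^2:\ T^2-X^2<1\},\qquad g=\frac{32m^3}{r}\,e^{-r/2m}\,(-dT^2+dX^2)+r^2\,d\Omega^2,$$ where $d\Omega^2$ is the round metric of the unit sphere $S^2$ and $r>0$ is determined by $(1-r/2m)\,e^{r/2m}=T^2-X^2$. Let $\mathcal H^{\pm}=\{T=\pm|X|\}$ be the future and past event horizons and $\Omega=\mathcal H^+\cap\mathcal H^-=\{T=X=0\}$ the bifurcation sphere. Let $k>2$ (with $k=\infty$ and $k=\omega$ allowed) and let $\Sigma\subset\mathcal M$ be a connected $C^k$ embedded hypersurface (without boundary) that is spacelike, i.e. $g$ is positive definite on its tangent spaces. Suppose that $\Sigma$ is time-symmetric: its extrinsic curvature $K(v,w)=g(w,\nabla_v N)$, where $N$ is a unit timelike normal of $\Sigma$, $\nabla$ is the Levi-Civita connection of $g$ and $v,w$ are tangent to $\Sigma$, vanishes at every point of $\Sigma$. Suppose also that $\Sigma$ is inextensible: it is not a proper subset of another connected $C^k$ spacelike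 embedded hypersurface of $\mathcal M$. Then $\Sigma\cap\Omega\neq\varnothing$. -/

import Mathlib

open scoped Manifold ContDiff Topology

noncomputable section

/-! ### Hypersurfaces and extrinsic curvature in a manifold with a metric tensor -/

section Hypersurfaces

/-- The differential `df_p(v)` of a real function on a manifold. -/
def differential {E H M : Type*} [NormedAddCommGroup E] [NormedSpace ℝ E]
    [TopologicalSpace H] (I : ModelWithCorners ℝ E H) [TopologicalSpace M] [ChartedSpace H M]
    (f : M → ℝ) (p : M) (v : TangentSpace I p) : ℝ :=
  mfderiv I 𝓘(ℝ, ℝ) f p v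

/-- `S` is a `C^k` embedded hypersurface (codimension one, no boundary) of `M`: near each of its
points it is the zero set of a `C^k` function whose differential does not vanish. -/
def IsEmbeddedHypersurface {E H M : Type*} [NormedAddCommGroup E] [NormedSpace ℝ E]
    [TopologicalSpace H] (I : ModelWithCorners ℝ E H) [TopologicalSpace M] [ChartedSpace H M]
    (k : WithTop ℕ∞) (S : Set M) : Prop :=
  ∀ p ∈ S, ∃ (W : Set M) (f : M → ℝ), IsOpen W ∧ p ∈ W ∧
    ContMDiffOn I 𝓘(ℝ, ℝ) k f W ∧
    (∀ q ∈ W, mfderiv I 𝓘(ℝ, ℝ) f q ≠ 0) ∧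
    ∀ q ∈ W, q ∈ S ↔ f q = 0

/-- The tangent space `T_p S` of an embedded submanifold `S`, as a subspace of `T_p M`: the vectors
annihilated by the differential at `p` of every `C^1` function that vanishes on `S` near `p`. -/
def submanifoldTangentSpace {E H M : Type*} [NormedAddCommGroup E] [NormedSpace ℝ E]
    [TopologicalSpace H] (I : ModelWithCorners ℝ E H) [TopologicalSpace M] [ChartedSpace H M]
    (S : Set M) (p : M) : Submodule ℝ (TangentSpace I p) where
  carrier := {v | ∀ f : M → ℝ, ContMDiffAt I 𝓘(ℝ, ℝ) 1 f p → (∀ᶠ q in 𝓝[S] p, f q = 0) →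
    differential I f p v = 0}
  zero_mem' := fun _ _ _ => map_zero _
  add_mem' := fun {a b} ha hb f hf h0 => by
    have h1 := ha f hf h0
    have h2 := hb f hf h0
    exact (map_add (mfderiv I 𝓘(ℝ, ℝ) f p) a b).trans
      ((congrArg₂ (fun x y : ℝ => x + y) h1 h2).trans (add_zero (0 : ℝ)))
  smul_mem' := fun c a ha f hf h0 => by
    have h1 := ha f hf h0
    exact (map_smul (mfderiv I 𝓘(ℝ, ℝ) f p) c a).trans
      ((congrArg (fun x : ℝ => c * x) h1).trans (mul_zero c))

/-- The hypersurface `S` is spacelike for the metric `g`: `g` is positive definite on its tangent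
spaces. -/
def IsSpacelike {E H M : Type*} [NormedAddCommGroup E] [NormedSpace ℝ E]
    [TopologicalSpace H] (I : ModelWithCorners ℝ E H) [TopologicalSpace M] [ChartedSpace H M]
    (g : ∀ p : M, TangentSpace I p → TangentSpace I p → ℝ) (S : Set M) : Prop :=
  ∀ p ∈ S, ∀ v ∈ submanifoldTangentSpace I S p, v ≠ 0 → 0 < g p v v

/-- `C^1` vector field near `p`. -/
def IsC1FieldAt {E H M : Type*} [NormedAddCommGroup E] [NormedSpace ℝ E]
    [TopologicalSpace H] (I : ModelWithCorners ℝ E H) [TopologicalSpace M] [ChartedSpace H M]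
    [IsManifold I 1 M] (X : ∀ p : M, TangentSpace I p) (p : M) : Prop :=
  ContMDiffAt I I.tangent 1 (fun q => (⟨q, X q⟩ : TangentBundle I M)) p

/-- The function `g(∇_X Y, Z)`, where `∇` is the Levi-Civita connection of `g`, given by the
Koszul formula. -/
def leviCivitaInner {E H M : Type*} [NormedAddCommGroup E] [NormedSpace ℝ E]
    [TopologicalSpace H] (I : ModelWithCorners ℝ E H) [TopologicalSpace M] [ChartedSpace H M]
    (g : ∀ p : M, TangentSpace I p → TangentSpace I p → ℝ)
    (X Y Z : ∀ p : M, TangentSpace I p) (p : M) : ℝ :=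
  (differential I (fun q => g q (Y q) (Z q)) p (X p)
    + differential I (fun q => g q (X q) (Z q)) p (Y p)
    - differential I (fun q => g q (X q) (Y q)) p (Z p)
    + g p (VectorField.mlieBracket I X Y p) (Z p)
    - g p (VectorField.mlieBracket I X Z p) (Y p)
    - g p (VectorField.mlieBracket I Y Z p) (X p)) / 2

/-- `N` is a `C^1` vector field near `p` whose restriction to `S` is, near `p`, a unit timelike
normal of `S`. -/
def IsUnitNormalNear {E H M : Type*} [NormedAddCommGroup E] [NormedSpace ℝ E]
    [TopologicalSpace H] (I : ModelWithCorners ℝ E H) [TopologicalSpace M] [ChartedSpace H M]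
    [IsManifold I 1 M] (g : ∀ p : M, TangentSpace I p → TangentSpace I p → ℝ)
    (S : Set M) (N : ∀ p : M, TangentSpace I p) (p : M) : Prop :=
  IsC1FieldAt I N p ∧
    ∀ᶠ q in 𝓝[S] p, g q (N q) (N q) = -1 ∧
      ∀ v ∈ submanifoldTangentSpace I S q, g q (N q) v = 0

/-- Extrinsic curvature `K(X, Y) = g(Y, ∇_X N)` at `p`, with respect to the unit normal `N`. -/
def extrinsicCurvature {E H M : Type*} [NormedAddCommGroup E] [NormedSpace ℝ E]
    [TopologicalSpace H] (I : ModelWithCorners ℝ E H) [TopologicalSpace M] [ChartedSpace H M]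
    (g : ∀ p : M, TangentSpace I p → TangentSpace I p → ℝ)
    (N X Y : ∀ p : M, TangentSpace I p) (p : M) : ℝ :=
  leviCivitaInner I g X N Y p

/-- `S` is time-symmetric: its extrinsic curvature vanishes at each of its points. (The value of
the extrinsic curvature at `p` does not depend on how the unit normal and the two tangent vectors
are extended to vector fields near `p`.) -/
def IsTimeSymmetric {E H M : Type*} [NormedAddCommGroup E] [NormedSpace ℝ E]
    [TopologicalSpace H] (I : ModelWithCorners ℝ E H) [TopologicalSpace M] [ChartedSpace H M]
    [IsManifold I 1 M] (g : ∀ p : M, TangentSpace I p → TangentSpace I p → ℝ)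
    (S : Set M) : Prop :=
  ∀ p ∈ S, ∀ N X Y : (∀ q : M, TangentSpace I q),
    IsUnitNormalNear I g S N p → IsC1FieldAt I X p → IsC1FieldAt I Y p →
    X p ∈ submanifoldTangentSpace I S p → Y p ∈ submanifoldTangentSpace I S p →
    extrinsicCurvature I g N X Y p = 0

/-- The hypersurface `S` is inextensible: it is not a proper subset of another connected `C^k`
spacelike embedded hypersurface. -/
def IsInextensible {E H M : Type*} [NormedAddCommGroup E] [NormedSpace ℝ E]
    [TopologicalSpace H] (I : ModelWithCorners ℝ E H) [TopologicalSpace M] [ChartedSpace H M]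
    (g : ∀ p : M, TangentSpace I p → TangentSpace I p → ℝ)
    (k : WithTop ℕ∞) (S : Set M) : Prop :=
  ¬ ∃ S' : Set M, IsEmbeddedHypersurface I k S' ∧ IsSpacelike I g S' ∧ IsConnected S' ∧ S ⊂ S'

end Hypersurfaces

/-! ### The Schwarzschild–Kruskal spacetime -/

namespace Kruskal

/-- Euclidean three-space. -/
abbrev Space3 : Type := EuclideanSpace ℝ (Fin 3)

/-- The unit two-sphere. -/
abbrev Sphere2 : Type := Metric.sphere (0 : Space3) 1

instance instFactFinrankSpace3 : Fact (Module.finrank ℝ Space3 = 2 + 1) :=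
  ⟨finrank_euclideanSpace_fin⟩

/-- The domain `T^2 - X^2 < 1` of the Kruskal coordinates `((T, X), ω)` in `ℝ² × S²`. -/
def domain : TopologicalSpace.Opens ((ℝ × ℝ) × Sphere2) where
  carrier := {z | z.1.1 ^ 2 - z.1.2 ^ 2 < 1}
  is_open' := isOpen_lt (by fun_prop) continuous_const

/-- The manifold underlying the Schwarzschild–Kruskal spacetime. -/
abbrev Spacetime : Type := domain

/-- The model with corners of the spacetime manifold. -/
abbrev model : ModelWithCorners ℝ ((ℝ × ℝ) × EuclideanSpace ℝ (Fin 2))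
    (ModelProd (ℝ × ℝ) (EuclideanSpace ℝ (Fin 2))) :=
  𝓘(ℝ, ℝ × ℝ).prod (𝓡 2)

/-- The Kruskal time coordinate `T`. -/
def T (p : Spacetime) : ℝ := p.1.1.1

/-- The Kruskal space coordinate `X`. -/
def X (p : Spacetime) : ℝ := p.1.1.2

/-- The angular position, a unit vector of `ℝ³`. -/
def angle (p : Spacetime) : Space3 := (p.1.2 : Space3)

/-- The relation between `s = r / 2m` and the Kruskal coordinates has exactly one solution. -/
theorem existsUnique_scaledRadius (p : Spacetime) :
    ∃! s : ℝ, 0 < s ∧ (1 - s) * Real.exp s = T p ^ 2 - X p ^ 2 := by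
  have hp : T p ^ 2 - X p ^ 2 < 1 := p.2
  set c := T p ^ 2 - X p ^ 2 with hc
  have hanti : StrictAntiOn (fun s : ℝ => (1 - s) * Real.exp s) (Set.Ici 0) := by
    apply strictAntiOn_of_deriv_neg (convex_Ici 0)
    · exact Continuous.continuousOn (by fun_prop)
    · intro x hx
      rw [interior_Ici] at hx
      have h : HasDerivAt (fun s : ℝ => (1 - s) * Real.exp s)
          ((-1) * Real.exp x + (1 - x) * Real.exp x) x :=
        ((hasDerivAt_id x).const_sub 1).mul (Real.hasDerivAt_exp x)
      rw [h.deriv]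
      have h1 : 0 < x := hx
      have := mul_pos h1 (Real.exp_pos x)
      linarith
  have hex : ∃ s : ℝ, 0 ≤ s ∧ (1 - s) * Real.exp s = c := by
    have hb : (0 : ℝ) ≤ 1 + |c| := by positivity
    have hle : (1 - (1 + |c|)) * Real.exp (1 + |c|) ≤ c := by
      have h1 : (1 : ℝ) ≤ Real.exp (1 + |c|) := Real.one_le_exp hb
      have h2 := neg_abs_le c
      nlinarith [abs_nonneg c]
    have hmem : c ∈ Set.Icc ((1 - (1 + |c|)) * Real.exp (1 + |c|)) ((1 - (0 : ℝ)) * Real.exp 0) :=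
      ⟨hle, by simpa using hp.le⟩
    obtain ⟨s, hs, hs'⟩ := intermediate_value_Icc' (f := fun s : ℝ => (1 - s) * Real.exp s) hb
      (Continuous.continuousOn (by fun_prop)) hmem
    exact ⟨s, hs.1, hs'⟩
  obtain ⟨s, hs0, hs⟩ := hex
  have hspos : 0 < s := by
    rcases hs0.eq_or_lt with h | h
    · subst h
      simp at hs
      linarith
    · exact h
  refine ⟨s, ⟨hspos, hs⟩, ?_⟩
  rintro t ⟨ht0, ht⟩
  exact hanti.injOn (Set.mem_Ici.2 ht0.le) (Set.mem_Ici.2 hs0) (ht.trans hs.symm)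

/-- The quotient `r / 2m`. -/
def scaledRadius (p : Spacetime) : ℝ := (existsUnique_scaledRadius p).choose

/-- The areal radius `r > 0` of the spacetime of mass `m`. -/
def arealRadius (m : ℝ) (p : Spacetime) : ℝ := 2 * m * scaledRadius p

/-- The areal radius is determined by `(1 - r / 2m) exp (r / 2m) = T^2 - X^2`. -/
theorem arealRadius_spec (m : ℝ) (hm : 0 < m) (p : Spacetime) :
    0 < arealRadius m p ∧ (1 - arealRadius m p / (2 * m)) * Real.exp (arealRadius m p / (2 * m)) =
      T p ^ 2 - X p ^ 2 := by
  have h := (existsUnique_scaledRadius p).choose_spec.1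
  have e : arealRadius m p / (2 * m) = scaledRadius p := by
    unfold arealRadius
    field_simp
  rw [e]
  exact ⟨mul_pos (by positivity) h.1, h.2⟩

/-- The differential of `T`. -/
def dT (p : Spacetime) (v : TangentSpace model p) : ℝ := differential model T p v

/-- The differential of `X`. -/
def dX (p : Spacetime) (v : TangentSpace model p) : ℝ := differential model X p v

/-- The differential of the angular position. -/
def dAngle (p : Spacetime) (v : TangentSpace model p) : Space3 :=
  mfderiv model 𝓘(ℝ, Space3) angle p v

/-- The Schwarzschild–Kruskal metric of mass `m`, of signature `(-, +, +, +)`: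
`(32 m³ / r) exp (-r / 2m) (-dT² + dX²) + r² dΩ²`. -/
def metric (m : ℝ) (p : Spacetime) (v w : TangentSpace model p) : ℝ :=
  32 * m ^ 3 / arealRadius m p * Real.exp (-arealRadius m p / (2 * m)) *
      (-(dT p v * dT p w) + dX p v * dX p w)
    + arealRadius m p ^ 2 * inner ℝ (dAngle p v) (dAngle p w)

/-- The future event horizon `H⁺`: the boundary of the black hole region `T > |X|`. -/
def futureHorizon : Set Spacetime := {p | T p = |X p|}

/-- The past event horizon `H⁻`: the boundary of the white hole region `T < -|X|`. -/
def pastHorizon : Set Spacetime := {p | T p = -|X p|}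

/-- The bifurcation sphere `Ω = H⁺ ∩ H⁻`. -/
def bifurcationSphere : Set Spacetime := futureHorizon ∩ pastHorizon

end Kruskal

end

/-! Suppose `S` misses the bifurcation sphere. Then `S` lies in a slice `T = c X` with `c ^ 2 < 1`.
That slice is itself a connected spacelike hypersurface and it meets the bifurcation sphere, so it
properly extends `S`, against inextensibility.

To find the slice, write `n` for the unit conormal and `ρ = r / 2m`. Time symmetry makes the unit
normal parallel along `S`, so tangential derivatives of `n` are given by Christoffel symbols. Pair
the normal with the boost Killing field `X ∂_T + T ∂_X`: the function `u = X n_T + T n_X` has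
differential `ρ⁻² (n_T dX + n_X dT)` along `S`, so this one-form is closed there. Let `σ = T n_T + X
n_X`, which up to a nonvanishing factor is the derivative of `r` along the normal. Closedness gives
`σ = 0` wherever `n` has an angular component (`radial_or_angular`). Where `σ ≠ 0`, `n` would have
no angular component nearby, and the bending of the round spheres again forces `σ = 0`
(`radial_eq_zero`).

Differentiating `σ = 0` shows that an angular component could survive only where `r = 3m`, and a
piece of `S` inside `r = 3m` contradicts the presence of that component (`angular_eq_zero`). Hence
`n` is proportional to `X dT - T dX`. Since `n` is timelike, `T² < X²`; moreover `T / X` is locally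
constant on `S`, hence constant by connectedness (`exists_subset_staticSlice`). -/

noncomputable section

/-! ### Calculus along the regular zero set of a function -/

section ZeroSets

open Filter

variable {E : Type*} [NormedAddCommGroup E] [NormedSpace ℝ E] [CompleteSpace E]

/-- A function which is constant on a regular level set has vanishing derivative along it. -/
theorem fderiv_apply_eq_zero_of_const_on_zeros {f h : E → ℝ} {x v : E}
    (hf : ContDiffAt ℝ 1 f x) (hh : ContDiffAt ℝ 1 h x) (hx : f x = 0) (hdf : fderiv ℝ f x ≠ 0)
    (hconst : ∀ᶠ y in 𝓝 x, f y = 0 → h y = h x) (hv : fderiv ℝ f x v = 0) :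
    fderiv ℝ h x v = 0 := by
  -- A function constant on the zero set is extremal there, so Lagrange multipliers give a
  -- nontrivial relation between the two derivatives; the coefficient of `h` is nonzero because that
  -- of `f` cannot stand alone.
  have hextr : IsLocalExtrOn h {y | f y = f x} x := by
    refine Or.inl ?_
    filter_upwards [mem_nhdsWithin_of_mem_nhds hconst, self_mem_nhdsWithin] with y hy hy'
    exact (hy (hy'.trans hx)).ge
  obtain ⟨a, b, hab, h0⟩ := hextr.exists_multipliers_of_hasStrictFDerivAt_1d
    (hf.hasStrictFDerivAt one_ne_zero) (hh.hasStrictFDerivAt one_ne_zero)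
  have hb : b ≠ 0 := by
    rintro rfl
    have ha : a ≠ 0 := by
      rintro rfl
      exact hab rfl
    simp only [zero_smul, add_zero] at h0
    exact hdf ((smul_eq_zero.1 h0).resolve_left ha)
  have h1 := DFunLike.congr_fun h0 v
  simpa [hv, hb] using h1

/-- If the derivative of `h` vanishes on the kernel of the derivative of `f` at the zeros of `f`,
then `h` is locally constant on the regular zero set of `f`. -/
theorem eventually_const_on_zeros [FiniteDimensional ℝ E] {f h : E → ℝ} {x : E}
    (hf : ContDiffAt ℝ 1 f x) (hh : ContDiffAt ℝ 1 h x) (hx : f x = 0) (hdf : fderiv ℝ f x ≠ 0)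
    (hker : ∀ᶠ y in 𝓝 x, f y = 0 → ∀ v, fderiv ℝ f y v = 0 → fderiv ℝ h y v = 0) :
    ∀ᶠ y in 𝓝 x, f y = 0 → h y = h x := by
  have hstrict := hf.hasStrictFDerivAt one_ne_zero
  have hrange : (fderiv ℝ f x).range = ⊤ := by
    refine LinearMap.range_eq_top.2 (LinearMap.surjective ?_)
    intro h0
    exact hdf (ContinuousLinearMap.coe_injective h0)
  -- The implicit function at level `0` yields a `C^1` map `ψ` parametrizing the zero set near `x`
  -- by the kernel of the derivative of `f`.
  let φ := HasStrictFDerivAt.implicitFunctionDataOfComplemented f (fderiv ℝ f x) hstrict hrange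
    (fderiv ℝ f x).ker_closedComplemented_of_finiteDimensional_range
  have hpt : φ.pt = x := rfl
  have hleft : φ.leftFun = f := rfl
  have hC : ContDiffAt ℝ 1 φ.implicitFunction.uncurry (φ.prodFun φ.pt) := by
    refine ImplicitFunctionData.contDiffAt_implicitFunction hf ?_ one_ne_zero
    change ContDiffAt ℝ 1 (fun y => Classical.choose
      (fderiv ℝ f x).ker_closedComplemented_of_finiteDimensional_range (y - x)) x
    fun_prop
  set s := φ.rightFun x with hs
  set ψ := φ.implicitFunction 0 with hψ
  have hψC : ContDiffAt ℝ 1 ψ s := by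
    have e : φ.prodFun φ.pt = (0, s) := by
      rw [ImplicitFunctionData.prodFun_apply, hleft, hpt, hx]
    rw [e] at hC
    exact ContDiffAt.comp (g := Function.uncurry φ.implicitFunction) s hC
      (contDiffAt_const.prodMk contDiffAt_id)
  have himg : ∀ᶠ y in 𝓝 x, f y = 0 → ψ (φ.rightFun y) = y := by
    filter_upwards [φ.implicitFunction_apply_image] with y hy h0
    rwa [hleft, h0] at hy
  have hψs : ψ s = x := himg.self_of_nhds hx
  have hzero : ∀ᶠ t in 𝓝 s, f (ψ t) = 0 := by
    have h1 := φ.leftFun_implicitFunction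
    rw [ImplicitFunctionData.prodFun_apply, hleft, hpt, hx] at h1
    have h2 := (Continuous.prodMk_right (0 : ℝ)).tendsto s |>.eventually h1
    exact h2
  have hcont : Tendsto ψ (𝓝 s) (𝓝 x) := by
    have := hψC.continuousAt
    rwa [ContinuousAt, hψs] at this
  have hgood : ∀ᶠ t in 𝓝 s, DifferentiableAt ℝ ψ t ∧ f (ψ t) = 0 ∧
      DifferentiableAt ℝ f (ψ t) ∧ DifferentiableAt ℝ h (ψ t) ∧
      ∀ v, fderiv ℝ f (ψ t) v = 0 → fderiv ℝ h (ψ t) v = 0 := by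
    filter_upwards [hψC.eventually (by simp), hzero,
      hcont.eventually (hf.eventually (by simp)), hcont.eventually (hh.eventually (by simp)),
      hcont.eventually hker] with t h1 h2 h3 h4 h5
    exact ⟨h1.differentiableAt one_ne_zero, h2, h3.differentiableAt one_ne_zero,
      h4.differentiableAt one_ne_zero, h5 h2⟩
  obtain ⟨ε, hε, hball⟩ := Metric.eventually_nhds_iff_ball.1 hgood
  -- As `f ∘ ψ` vanishes, the derivative of `ψ` takes values in the kernel of that of `f`, which the
  -- derivative of `h` annihilates.
  have hderiv : ∀ t ∈ Metric.ball s ε, HasFDerivAt (fun t => h (ψ t)) (0 : _ →L[ℝ] ℝ) t := by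
    intro t ht
    obtain ⟨h1, h2, h3, h4, h5⟩ := hball t ht
    have hfψ : HasFDerivAt (fun t => f (ψ t)) (0 : _ →L[ℝ] ℝ) t := by
      refine (hasFDerivAt_const (0 : ℝ) t).congr_of_eventuallyEq ?_
      filter_upwards [Metric.isOpen_ball.mem_nhds ht] with t' ht'
      exact (hball t' ht').2.1
    have hfψ' := h3.hasFDerivAt.comp t h1.hasFDerivAt
    have heq := hfψ'.unique hfψ
    have hcomp : (0 : _ →L[ℝ] ℝ) = (fderiv ℝ h (ψ t)).comp (fderiv ℝ ψ t) :=
      ContinuousLinearMap.ext fun v => (h5 _ (DFunLike.congr_fun heq v)).symm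
    rw [hcomp]
    exact h4.hasFDerivAt.comp t h1.hasFDerivAt
  have hconst : ∀ t ∈ Metric.ball s ε, h (ψ t) = h (ψ s) := by
    intro t ht
    refine (Metric.isOpen_ball (x := s) (ε := ε)).is_const_of_fderiv_eq_zero
      (convex_ball s ε).isPreconnected (f := fun t => h (ψ t))
      (fun t ht => (hderiv t ht).differentiableAt.differentiableWithinAt)
      (fun t ht => (hderiv t ht).fderiv) ht (Metric.mem_ball_self hε)
  have hright : Tendsto φ.rightFun (𝓝 x) (𝓝 s) := φ.hasStrictFDerivAt_rightFun.continuousAt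
  filter_upwards [himg, hright.eventually (Metric.ball_mem_nhds s hε)] with y h1 h2 h0
  have := hconst _ h2
  rwa [h1 h0, hψs] at this

/-- A one-form which agrees with an exact one-form along a regular zero set is closed along it. -/
theorem fderiv_symm_of_eq_fderiv_on_zeros {f u : E → ℝ} {θ : E → E →L[ℝ] ℝ} {x v w : E}
    (hf : ContDiffAt ℝ 2 f x) (hu : ContDiffAt ℝ 2 u x) (hθ : ContDiffAt ℝ 1 θ x)
    (hx : f x = 0) (hdf : fderiv ℝ f x ≠ 0)
    (h : ∀ᶠ y in 𝓝 x, f y = 0 → ∀ v, fderiv ℝ f y v = 0 → fderiv ℝ u y v = θ y v)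
    (hv : fderiv ℝ f x v = 0) (hw : fderiv ℝ f x w = 0) :
    fderiv ℝ θ x v w = fderiv ℝ θ x w v := by
  obtain ⟨e, he⟩ : ∃ e, fderiv ℝ f x e ≠ 0 := by
    by_contra! h0
    exact hdf (ContinuousLinearMap.ext h0)
  have hDf : ContDiffAt ℝ 1 (fderiv ℝ f) x := hf.fderiv_right (m := 1) (by norm_num)
  have hDu : ContDiffAt ℝ 1 (fderiv ℝ u) x := hu.fderiv_right (m := 1) (by norm_num)
  have hfsymm := hf.isSymmSndFDerivAt (by simp)
  have husymm := hu.isSymmSndFDerivAt (by simp)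
  -- On tangent vectors, the Hessian of `u` minus the derivative of `θ` is a multiple of the Hessian
  -- of `f`. Both Hessians are symmetric, so the derivative of `θ` is too.
  have key : ∀ v w, fderiv ℝ f x v = 0 → fderiv ℝ f x w = 0 →
      fderiv ℝ (fderiv ℝ u) x v w - fderiv ℝ θ x v w
        = (fderiv ℝ u x e - θ x e) * fderiv ℝ (fderiv ℝ f) x v w / fderiv ℝ f x e := by
    intro v w hv hw
    -- This field is tangent to the level sets of `f` and is a nonzero multiple of `w` at `x`. Since
    -- `du - θ` vanishes on it along the zero set, that pairing can be differentiated along `v`.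
    have hV : ContDiffAt ℝ 1 (fun y => fderiv ℝ f y e • w - fderiv ℝ f y w • e) x :=
      ((hDf.clm_apply contDiffAt_const).smul contDiffAt_const).sub
        ((hDf.clm_apply contDiffAt_const).smul contDiffAt_const)
    have hα : ContDiffAt ℝ 1 (fun y => fderiv ℝ u y - θ y) x := hDu.sub hθ
    have hzero : ∀ᶠ y in 𝓝 x, f y = 0 →
        (fderiv ℝ u y - θ y) (fderiv ℝ f y e • w - fderiv ℝ f y w • e) = 0 := by
      filter_upwards [h] with y hy h0
      have := hy h0 (fderiv ℝ f y e • w - fderiv ℝ f y w • e) (by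
        simp only [map_sub, map_smul, smul_eq_mul]
        ring)
      rw [sub_apply, this, sub_self]
    have h1 := fderiv_apply_eq_zero_of_const_on_zeros (hf.of_le (by norm_num))
      (hα.clm_apply hV) hx hdf (by
        filter_upwards [hzero] with y hy h0
        rw [hy h0, hzero.self_of_nhds hx]) hv
    have hD := (hDf.differentiableAt one_ne_zero).hasFDerivAt
    have hd := ((hDu.differentiableAt one_ne_zero).hasFDerivAt.fun_sub
      (hθ.differentiableAt one_ne_zero).hasFDerivAt).clm_apply
      (((hD.clm_apply (hasFDerivAt_const e x)).smul_const w).fun_sub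
        ((hD.clm_apply (hasFDerivAt_const w x)).smul_const e))
    have hw' : fderiv ℝ u x w = θ x w := h.self_of_nhds hx w hw
    rw [hd.fderiv] at h1
    simp [hw, hw'] at h1
    field_simp
    linarith
  have h1 := key v w hv hw
  have h2 := key w v hw hv
  have e1 : fderiv ℝ (fderiv ℝ u) x v w = fderiv ℝ (fderiv ℝ u) x w v := husymm v w
  have e2 : fderiv ℝ (fderiv ℝ f) x v w = fderiv ℝ (fderiv ℝ f) x w v := hfsymm v w
  rw [e1, e2] at h1
  linarith

end ZeroSets

/-! ### The radius as a smooth function of `T² - X²` -/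

namespace Kruskal

open Filter

/-- The function `r / 2m` of the variable `z = T² - X²`. -/
def rho (z : ℝ) : ℝ := Function.invFunOn (fun s : ℝ => (1 - s) * Real.exp s) (Set.Ioi 0) z

theorem exists_T_X_eq {z : ℝ} (hz : z < 1) : ∃ p : Spacetime, T p ^ 2 - X p ^ 2 = z := by
  have hξ : ∃ ξ : Space3, ξ ∈ Metric.sphere (0 : Space3) 1 := ⟨EuclideanSpace.single 0 1, by simp⟩
  obtain ⟨ξ, hξ⟩ := hξ
  have h1 : (Real.sqrt (max z 0)) ^ 2 - (Real.sqrt (max (-z) 0)) ^ 2 = z := by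
    rw [Real.sq_sqrt (le_max_right _ _), Real.sq_sqrt (le_max_right _ _)]
    rcases le_total 0 z with h | h
    · rw [max_eq_left h, max_eq_right (by linarith), sub_zero]
    · rw [max_eq_right h, max_eq_left (by linarith), zero_sub, neg_neg]
  exact ⟨⟨((Real.sqrt (max z 0), Real.sqrt (max (-z) 0)), ⟨ξ, hξ⟩), lt_of_eq_of_lt h1 hz⟩, h1⟩

theorem existsUnique_rho {z : ℝ} (hz : z < 1) :
    ∃! s : ℝ, 0 < s ∧ (1 - s) * Real.exp s = z := by
  obtain ⟨p, rfl⟩ := exists_T_X_eq hz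
  exact existsUnique_scaledRadius p

theorem rho_spec {z : ℝ} (hz : z < 1) : 0 < rho z ∧ (1 - rho z) * Real.exp (rho z) = z := by
  obtain ⟨s, hs, -⟩ := existsUnique_rho hz
  exact Function.invFunOn_pos (f := fun s : ℝ => (1 - s) * Real.exp s) (s := Set.Ioi 0) ⟨s, hs⟩

theorem rho_pos {z : ℝ} (hz : z < 1) : 0 < rho z := (rho_spec hz).1

theorem rho_eq {z s : ℝ} (hz : z < 1) (hs : 0 < s) (h : (1 - s) * Real.exp s = z) : rho z = s :=
  (existsUnique_rho hz).unique (rho_spec hz) ⟨hs, h⟩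

theorem scaledRadius_eq_rho (p : Spacetime) : scaledRadius p = rho (T p ^ 2 - X p ^ 2) :=
  (rho_eq p.2 (existsUnique_scaledRadius p).choose_spec.1.1
    (existsUnique_scaledRadius p).choose_spec.1.2).symm

theorem hasDerivAt_one_sub_mul_exp (s : ℝ) :
    HasDerivAt (fun s : ℝ => (1 - s) * Real.exp s) (-(s * Real.exp s)) s := by
  have h := ((hasDerivAt_id s).const_sub 1).mul (Real.hasDerivAt_exp s)
  refine h.congr_deriv ?_
  simp only [id]
  ring

/-- The inverse function theorem gives a smooth local inverse of `s ↦ (1 - s) exp s`. By continuity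
it stays positive, so uniqueness of the positive solution identifies it with `rho`. -/
theorem contDiffAt_rho {z : ℝ} (hz : z < 1) {n : ℕ∞} : ContDiffAt ℝ n rho z := by
  have hpos := rho_pos hz
  -- The inverse function theorem needs order at least one; order zero follows from order one.
  wlog hn : (n : WithTop ℕ∞) ≠ 0 generalizing n
  · exact (this (n := 1) one_ne_zero).of_le (by simp_all)
  have hC : ContDiffAt ℝ n (fun s : ℝ => (1 - s) * Real.exp s) (rho z) := by fun_prop
  have hne : -(rho z * Real.exp (rho z)) ≠ 0 := neg_ne_zero.2 (by positivity)
  have hd : HasFDerivAt (fun s : ℝ => (1 - s) * Real.exp s)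
      (ContinuousLinearEquiv.unitsEquivAut ℝ (Units.mk0 _ hne) : ℝ →L[ℝ] ℝ) (rho z) :=
    (hasDerivAt_one_sub_mul_exp (rho z)).hasFDerivAt_equiv hne
  have hL := hC.to_localInverse hd hn
  have hz' : (1 - rho z) * Real.exp (rho z) = z := (rho_spec hz).2
  have hself := hC.localInverse_apply_image hd hn
  simp only [hz'] at hL hself
  refine hL.congr_of_eventuallyEq ?_
  have hright := (hC.hasStrictFDerivAt' hd hn).eventually_right_inverse
  simp only [hz'] at hright
  have hp : ∀ᶠ y in 𝓝 z, 0 < hC.localInverse hd hn y :=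
    hL.continuousAt.eventually_const_lt (by rwa [hself])
  filter_upwards [hright, hp, eventually_lt_nhds hz] with y h1 h2 h3
  exact rho_eq h3 h2 h1

theorem hasDerivAt_rho {z : ℝ} (hz : z < 1) :
    HasDerivAt rho (-(Real.exp (-rho z) / rho z)) z := by
  have hpos := rho_pos hz
  have h1 := ((contDiffAt_rho hz (n := 1)).differentiableAt one_ne_zero).hasDerivAt
  have h2 := (hasDerivAt_one_sub_mul_exp (rho z)).comp z h1
  have h3 : HasDerivAt ((fun s : ℝ => (1 - s) * Real.exp s) ∘ rho) 1 z := by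
    refine (hasDerivAt_id z).congr_of_eventuallyEq ?_
    filter_upwards [eventually_lt_nhds hz] with y hy
    exact (rho_spec hy).2
  have h4 := h2.unique h3
  refine h1.congr_deriv ?_
  rw [Real.exp_neg]
  have := Real.exp_pos (rho z)
  field_simp
  linarith

end Kruskal

/-! ### Totally geodesic hypersurfaces in Kruskal coordinates -/

namespace Kruskal

open Filter

/-- The vector space `ℝ² × ℝ²` in which charts of the spacetime take values. -/
abbrev Coord : Type := (ℝ × ℝ) × EuclideanSpace ℝ (Fin 2)

/-- The coordinate vector `∂_T`. -/
abbrev vecT : Coord := ((1, 0), 0)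

/-- The coordinate vector `∂_X`. -/
abbrev vecX : Coord := ((0, 1), 0)

/-- The function `T² - X²` in a chart. -/
def zval (x : Coord) : ℝ := x.1.1 ^ 2 - x.1.2 ^ 2

/-- The factor relating the logarithmic derivatives of the metric coefficients to `T`, `X`. -/
def dfac (x : Coord) : ℝ := Real.exp (-rho (zval x)) / rho (zval x) ^ 2

/-- The equations satisfied along `{f = 0}` by the unit conormal `n` of a spacelike totally
geodesic hypersurface `{f = 0}` of the Kruskal spacetime, in a chart. -/
structure IsGeodesicConormal (f : Coord → ℝ) (n : Coord → Coord →L[ℝ] ℝ) (V : Set Coord) :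
    Prop where
  isOpen : IsOpen V
  zval_lt_one : ∀ x ∈ V, zval x < 1
  contDiffAt_fun : ∀ x ∈ V, ContDiffAt ℝ 2 f x
  contDiffAt_conormal : ∀ x ∈ V, ContDiffAt ℝ 2 n x
  exists_smul : ∀ x ∈ V, ∃ c : ℝ, c ≠ 0 ∧ n x = c • fderiv ℝ f x
  timelike : ∀ x ∈ V, f x = 0 → n x vecX ^ 2 < n x vecT ^ 2
  fderiv_vecT : ∀ x ∈ V, f x = 0 → ∀ v, n x v = 0 → fderiv ℝ n x v vecT =
    dfac x * ((rho (zval x) + 1) * (x.1.1 * (n x vecT * v.1.1 + n x vecX * v.1.2)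
      - x.1.2 * (n x vecT * v.1.2 + n x vecX * v.1.1))
      + 2 * x.1.1 * (n x vecT * v.1.1 + n x vecX * v.1.2))
  fderiv_vecX : ∀ x ∈ V, f x = 0 → ∀ v, n x v = 0 → fderiv ℝ n x v vecX =
    dfac x * ((rho (zval x) + 1) * (-x.1.2 * (n x vecT * v.1.1 + n x vecX * v.1.2)
      + x.1.1 * (n x vecT * v.1.2 + n x vecX * v.1.1))
      - 2 * x.1.2 * (n x vecT * v.1.1 + n x vecX * v.1.2))
  fderiv_angular : ∀ x ∈ V, f x = 0 → (∀ y, n x (0, y) = 0) → ∀ y, y ≠ 0 → ∃ κ : ℝ, κ ≠ 0 ∧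
    fderiv ℝ n x (0, y) (0, y) = κ * (x.1.1 * n x vecT + x.1.2 * n x vecX)
  ne_bifurcation : ∀ x ∈ V, f x = 0 → x.1 ≠ 0

theorem coord_decomp (l : Coord →L[ℝ] ℝ) (v : Coord) :
    l v = l vecT * v.1.1 + l vecX * v.1.2 + l (0, v.2) := by
  have : v = v.1.1 • vecT + v.1.2 • vecX + ((0, v.2) : Coord) := by
    ext <;> simp
  conv_lhs => rw [this]
  simp only [map_add, map_smul, smul_eq_mul]
  ring

/-- The defining relation of `rho` with the exponential absorbed into `dfac`. It makes the
derivative identities for the boost and radial functions rational in the remaining quantities. -/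
theorem rho_zval {x : Coord} (hx : zval x < 1) :
    dfac x * (x.1.1 ^ 2 - x.1.2 ^ 2) * rho (zval x) ^ 2 = 1 - rho (zval x) := by
  have h := rho_spec hx
  have hpos := h.1
  have h2 : x.1.1 ^ 2 - x.1.2 ^ 2 = (1 - rho (zval x)) * Real.exp (rho (zval x)) := h.2.symm
  unfold dfac
  rw [Real.exp_neg]
  have he := (Real.exp_pos (rho (zval x)))
  field_simp
  linarith

theorem hasFDerivAt_fst_fst (x : Coord) : HasFDerivAt (fun x : Coord => x.1.1)
    ((ContinuousLinearMap.fst ℝ ℝ ℝ).comp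
      (ContinuousLinearMap.fst ℝ (ℝ × ℝ) (EuclideanSpace ℝ (Fin 2)))) x :=
  hasFDerivAt_fst.comp x hasFDerivAt_fst

theorem hasFDerivAt_fst_snd (x : Coord) : HasFDerivAt (fun x : Coord => x.1.2)
    ((ContinuousLinearMap.snd ℝ ℝ ℝ).comp
      (ContinuousLinearMap.fst ℝ (ℝ × ℝ) (EuclideanSpace ℝ (Fin 2)))) x :=
  hasFDerivAt_snd.comp x hasFDerivAt_fst

theorem hasFDerivAt_zval (x : Coord) : ∃ L : Coord →L[ℝ] ℝ, HasFDerivAt zval L x ∧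
    ∀ v, L v = 2 * (x.1.1 * v.1.1 - x.1.2 * v.1.2) := by
  refine ⟨_, ((hasFDerivAt_fst_fst x).pow 2).sub ((hasFDerivAt_fst_snd x).pow 2), fun v => ?_⟩
  simp
  ring

theorem contDiff_zval {n : ℕ∞} : ContDiff ℝ n zval := by
  unfold zval
  fun_prop

theorem contDiffAt_rho_zval {x : Coord} (hx : zval x < 1) {n : ℕ∞} :
    ContDiffAt ℝ n (fun x => rho (zval x)) x :=
  (contDiffAt_rho hx).comp x contDiff_zval.contDiffAt

theorem hasFDerivAt_rho_zval {x : Coord} (hx : zval x < 1) : ∃ L : Coord →L[ℝ] ℝ,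
    HasFDerivAt (fun x => rho (zval x)) L x ∧
      ∀ v, L v = -(2 * dfac x * rho (zval x)) * (x.1.1 * v.1.1 - x.1.2 * v.1.2) := by
  obtain ⟨L, hL, hL'⟩ := hasFDerivAt_zval x
  refine ⟨_, (hasDerivAt_rho hx).comp_hasFDerivAt x hL, fun v => ?_⟩
  have := rho_pos hx
  simp only [dfac, smul_apply, hL', smul_eq_mul]
  field_simp

namespace IsGeodesicConormal

variable {f : Coord → ℝ} {n : Coord → Coord →L[ℝ] ℝ} {V : Set Coord} {x : Coord}

theorem fderiv_apply_eq_zero_iff (h : IsGeodesicConormal f n V) (hx : x ∈ V) (v : Coord) :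
    fderiv ℝ f x v = 0 ↔ n x v = 0 := by
  obtain ⟨c, hc, hn⟩ := h.exists_smul x hx
  simp [hn, hc]

theorem conormal_vecT_ne_zero (h : IsGeodesicConormal f n V) (hx : x ∈ V) (h0 : f x = 0) :
    n x vecT ≠ 0 := by
  intro h1
  have := h.timelike x hx h0
  rw [h1] at this
  nlinarith [sq_nonneg (n x vecX)]

theorem fderiv_ne_zero (h : IsGeodesicConormal f n V) (hx : x ∈ V) (h0 : f x = 0) :
    fderiv ℝ f x ≠ 0 := by
  intro h1
  apply h.conormal_vecT_ne_zero hx h0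
  rw [← h.fderiv_apply_eq_zero_iff hx, h1]
  rfl

theorem hasFDerivAt_conormal (h : IsGeodesicConormal f n V) (hx : x ∈ V) :
    HasFDerivAt n (fderiv ℝ n x) x :=
  ((h.contDiffAt_conormal x hx).differentiableAt two_ne_zero).hasFDerivAt

theorem contDiffAt_apply (h : IsGeodesicConormal f n V) (hx : x ∈ V) (v : Coord) :
    ContDiffAt ℝ 2 (fun x => n x v) x :=
  (h.contDiffAt_conormal x hx).clm_apply contDiffAt_const

theorem fderiv_eq_zero_of_const (h : IsGeodesicConormal f n V) (hx : x ∈ V) (h0 : f x = 0)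
    {u : Coord → ℝ} (hu : ContDiffAt ℝ 1 u x) (hc : ∀ᶠ y in 𝓝 x, f y = 0 → u y = u x)
    {v : Coord} (hv : n x v = 0) : fderiv ℝ u x v = 0 :=
  fderiv_apply_eq_zero_of_const_on_zeros ((h.contDiffAt_fun x hx).of_le (by norm_num)) hu h0
    (h.fderiv_ne_zero hx h0) hc ((h.fderiv_apply_eq_zero_iff hx v).2 hv)

/-- The boost Killing field paired with the unit normal has differential
`(2m / r)² (n_T dX + n_X dT)` along the hypersurface. -/
theorem fderiv_boost (h : IsGeodesicConormal f n V) (hx : x ∈ V) (h0 : f x = 0) {v : Coord}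
    (hv : n x v = 0) :
    fderiv ℝ (fun x : Coord => x.1.2 * n x vecT + x.1.1 * n x vecX) x v
      = (rho (zval x) ^ 2)⁻¹ * (n x vecT * v.1.2 + n x vecX * v.1.1) := by
  have hn := h.hasFDerivAt_conormal hx
  have hd := ((hasFDerivAt_fst_snd x).mul (hn.clm_apply (hasFDerivAt_const vecT x))).add
    ((hasFDerivAt_fst_fst x).mul (hn.clm_apply (hasFDerivAt_const vecX x)))
  have e := DFunLike.congr_fun hd.fderiv v
  refine e.trans ?_
  have hρ := rho_pos (h.zval_lt_one x hx)
  have hz := rho_zval (h.zval_lt_one x hx)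
  simp [h.fderiv_vecT x hx h0 v hv, h.fderiv_vecX x hx h0 v hv]
  set ρ := rho (zval x)
  field_simp
  linear_combination (n x vecT * v.1.2 + n x vecX * v.1.1) * (ρ + 1) * hz

/-- The derivative of `T n_T + X n_X` along the hypersurface. -/
theorem fderiv_radial (h : IsGeodesicConormal f n V) (hx : x ∈ V) (h0 : f x = 0) {v : Coord}
    (hv : n x v = 0) :
    fderiv ℝ (fun x : Coord => x.1.1 * n x vecT + x.1.2 * n x vecX) x v
      = (3 - 2 * rho (zval x)) / rho (zval x) ^ 2 * (n x vecT * v.1.1 + n x vecX * v.1.2) := by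
  have hn := h.hasFDerivAt_conormal hx
  have hd := ((hasFDerivAt_fst_fst x).mul (hn.clm_apply (hasFDerivAt_const vecT x))).add
    ((hasFDerivAt_fst_snd x).mul (hn.clm_apply (hasFDerivAt_const vecX x)))
  have e := DFunLike.congr_fun hd.fderiv v
  refine e.trans ?_
  have hρ := rho_pos (h.zval_lt_one x hx)
  have hz := rho_zval (h.zval_lt_one x hx)
  simp [h.fderiv_vecT x hx h0 v hv, h.fderiv_vecX x hx h0 v hv]
  set ρ := rho (zval x)
  field_simp
  linear_combination (n x vecT * v.1.1 + n x vecX * v.1.2) * (ρ + 3) * hz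

/-- The one-form `(2m / r)² (n_T dX + n_X dT)`. -/
def boostForm (n : Coord → Coord →L[ℝ] ℝ) (x : Coord) : Coord →L[ℝ] ℝ :=
  (rho (zval x) ^ 2)⁻¹ •
    (n x vecT • (ContinuousLinearMap.snd ℝ ℝ ℝ).comp
        (ContinuousLinearMap.fst ℝ (ℝ × ℝ) (EuclideanSpace ℝ (Fin 2)))
      + n x vecX • (ContinuousLinearMap.fst ℝ ℝ ℝ).comp
        (ContinuousLinearMap.fst ℝ (ℝ × ℝ) (EuclideanSpace ℝ (Fin 2))))

theorem contDiffAt_boostForm (h : IsGeodesicConormal f n V) (hx : x ∈ V) :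
    ContDiffAt ℝ 1 (boostForm n) x := by
  have hρ := rho_pos (h.zval_lt_one x hx)
  have h1 : ContDiffAt ℝ 1 (fun x => (rho (zval x) ^ 2)⁻¹) x :=
    ((contDiffAt_rho_zval (h.zval_lt_one x hx) (n := 1)).pow 2).inv (by positivity)
  have h2 := (h.contDiffAt_apply hx vecT).of_le (m := 1) (by norm_num)
  have h3 := (h.contDiffAt_apply hx vecX).of_le (m := 1) (by norm_num)
  exact h1.smul ((h2.smul contDiffAt_const).add (h3.smul contDiffAt_const))

theorem fderiv_boostForm (h : IsGeodesicConormal f n V) (hx : x ∈ V) (v w : Coord) :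
    fderiv ℝ (boostForm n) x v w = (rho (zval x) ^ 2)⁻¹ *
      (fderiv ℝ n x v vecT * w.1.2 + fderiv ℝ n x v vecX * w.1.1
        + 4 * dfac x * (x.1.1 * v.1.1 - x.1.2 * v.1.2)
          * (n x vecT * w.1.2 + n x vecX * w.1.1)) := by
  have hρ := rho_pos (h.zval_lt_one x hx)
  obtain ⟨L, hL, hL'⟩ := hasFDerivAt_rho_zval (h.zval_lt_one x hx)
  have hinv : HasFDerivAt (fun x => (rho (zval x) ^ 2)⁻¹)
      ((-(((rho (zval x)) ^ 2) ^ 2)⁻¹) • ((2 : ℕ) • rho (zval x) ^ (2 - 1)) • L) x :=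
    (hasDerivAt_inv (by positivity : rho (zval x) ^ 2 ≠ 0)).comp_hasFDerivAt x (hL.pow 2)
  have hn := h.hasFDerivAt_conormal hx
  have hd := hinv.smul (((hn.clm_apply (hasFDerivAt_const vecT x)).smul_const
      ((ContinuousLinearMap.snd ℝ ℝ ℝ).comp
        (ContinuousLinearMap.fst ℝ (ℝ × ℝ) (EuclideanSpace ℝ (Fin 2))))).add
      ((hn.clm_apply (hasFDerivAt_const vecX x)).smul_const
      ((ContinuousLinearMap.fst ℝ ℝ ℝ).comp
        (ContinuousLinearMap.fst ℝ (ℝ × ℝ) (EuclideanSpace ℝ (Fin 2))))))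
  have e := DFunLike.congr_fun (DFunLike.congr_fun hd.fderiv v) w
  refine e.trans ?_
  simp [hL']
  field_simp
  ring

/-- The boost form is the differential of a function along the hypersurface, hence closed there. If
`n` is nonzero on some `(0, y)`, adding multiples of `y` turns `∂_T` and `∂_X` into tangent vectors,
and closedness on this pair reads `6 * dfac x * σ = 0`. -/
theorem radial_or_angular (h : IsGeodesicConormal f n V) (hx : x ∈ V) (h0 : f x = 0) :
    x.1.1 * n x vecT + x.1.2 * n x vecX = 0 ∨ ∀ y, n x (0, y) = 0 := by
  by_contra! hcon
  obtain ⟨hσ, y, hy⟩ := hcon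
  apply hσ
  set v : Coord := ((1, 0), -(n x vecT / n x (0, y)) • y) with hvdef
  set w : Coord := ((0, 1), -(n x vecX / n x (0, y)) • y) with hwdef
  have hsm : ∀ c : ℝ, n x (0, c • y) = c * n x (0, y) := fun c => by
    have : ((0, c • y) : Coord) = c • ((0, y) : Coord) := by simp
    rw [this, map_smul, smul_eq_mul]
  have hv : n x v = 0 := by
    rw [coord_decomp, hvdef]
    simp only [hsm]
    field_simp
    ring
  have hw : n x w = 0 := by
    rw [coord_decomp, hwdef]
    simp only [hsm]
    field_simp
    ring
  have hsymm := fderiv_symm_of_eq_fderiv_on_zeros (h.contDiffAt_fun x hx)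
    (u := fun x : Coord => x.1.2 * n x vecT + x.1.1 * n x vecX) (θ := boostForm n)
    (by
      have := h.contDiffAt_apply hx vecT
      have := h.contDiffAt_apply hx vecX
      fun_prop) (h.contDiffAt_boostForm hx) h0
    (h.fderiv_ne_zero hx h0) (by
      filter_upwards [h.isOpen.mem_nhds hx] with y hy hy0 v hv
      rw [h.fderiv_boost hy hy0 ((h.fderiv_apply_eq_zero_iff hy v).1 hv)]
      simp [boostForm, mul_add])
    ((h.fderiv_apply_eq_zero_iff hx v).2 hv) ((h.fderiv_apply_eq_zero_iff hx w).2 hw)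
  rw [h.fderiv_boostForm hx, h.fderiv_boostForm hx, h.fderiv_vecT x hx h0 v hv,
    h.fderiv_vecT x hx h0 w hw, h.fderiv_vecX x hx h0 v hv, h.fderiv_vecX x hx h0 w hw] at hsymm
  have hρ := rho_pos (h.zval_lt_one x hx)
  have hdf : dfac x ≠ 0 := by
    unfold dfac
    positivity
  have hsymm' := mul_left_cancel₀ (inv_ne_zero (by positivity)) hsymm
  simp only [hvdef, hwdef] at hsymm'
  have : dfac x * (x.1.1 * n x vecT + x.1.2 * n x vecX) = 0 := by linarith
  exact (mul_eq_zero.1 this).resolve_left hdf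

/-- Where `σ ≠ 0`, an open condition, the angular part of `n` vanishes along the nearby
hypersurface, so its derivative in angular directions is zero. By `fderiv_angular` that derivative
is a nonzero multiple of `σ`. -/
theorem radial_eq_zero (h : IsGeodesicConormal f n V) (hx : x ∈ V) (h0 : f x = 0) :
    x.1.1 * n x vecT + x.1.2 * n x vecX = 0 := by
  by_contra hσ
  have hcont : ContinuousAt (fun x : Coord => x.1.1 * n x vecT + x.1.2 * n x vecX) x := by
    have := (h.contDiffAt_apply hx vecT).continuousAt
    have := (h.contDiffAt_apply hx vecX).continuousAt
    fun_prop
  have hang : ∀ᶠ y in 𝓝 x, f y = 0 → ∀ w, n y (0, w) = 0 := by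
    filter_upwards [h.isOpen.mem_nhds hx, hcont.eventually_ne hσ] with y hy hne hy0
    exact (h.radial_or_angular hy hy0).resolve_left hne
  have hangx := hang.self_of_nhds h0
  obtain ⟨y, hy⟩ := exists_ne (0 : EuclideanSpace ℝ (Fin 2))
  obtain ⟨κ, hκ, hD⟩ := h.fderiv_angular x hx h0 hangx y hy
  have h1 := h.fderiv_eq_zero_of_const hx h0 (u := fun x => n x (0, y))
    ((h.contDiffAt_apply hx _).of_le (by norm_num)) (by
      filter_upwards [hang] with z hz hz0
      rw [hz hz0, hangx]) (v := (0, y)) (hangx y)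
  have hd := (h.hasFDerivAt_conormal hx).clm_apply (hasFDerivAt_const ((0, y) : Coord) x)
  rw [hd.fderiv] at h1
  simp [hD, hκ] at h1
  exact hσ h1

/-- If the angular part is nonzero, `∂_T` and `∂_X` lift to tangent vectors. Differentiating `σ = 0`
along the first lift gives `rho = 3 / 2`, i.e. `r = 3m`, on the nearby hypersurface. Then `T² - X²`
is constant there, and its differential vanishes on both lifts only if `T = X = 0`. -/
theorem angular_eq_zero (h : IsGeodesicConormal f n V) (hx : x ∈ V) (h0 : f x = 0)
    (y : EuclideanSpace ℝ (Fin 2)) : n x (0, y) = 0 := by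
  by_contra hy
  have hsm : ∀ (x : Coord) (c : ℝ), n x (0, c • y) = c * n x (0, y) := fun x c => by
    have : ((0, c • y) : Coord) = c • ((0, y) : Coord) := by simp
    rw [this, map_smul, smul_eq_mul]
  have hv : ∀ (x : Coord), n x (0, y) ≠ 0 → ∀ a b : ℝ,
      n x ((a, b), -((n x vecT * a + n x vecX * b) / n x (0, y)) • y) = 0 := by
    intro x hy a b
    rw [coord_decomp]
    simp only [hsm]
    field_simp
    ring
  have hne : ∀ᶠ z in 𝓝 x, n z (0, y) ≠ 0 :=
    (h.contDiffAt_apply hx (0, y)).continuousAt.eventually_ne hy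
  have hρ : ∀ᶠ z in 𝓝 x, f z = 0 → rho (zval z) = 3 / 2 := by
    filter_upwards [hne, h.isOpen.mem_nhds hx] with z hz hzV hz0
    have h1 := h.fderiv_eq_zero_of_const hzV hz0
      (u := fun x : Coord => x.1.1 * n x vecT + x.1.2 * n x vecX) (by
        have := (h.contDiffAt_apply hzV vecT).of_le (m := 1) (by norm_num)
        have := (h.contDiffAt_apply hzV vecX).of_le (m := 1) (by norm_num)
        fun_prop) (by
        filter_upwards [h.isOpen.mem_nhds hzV] with y hy hy0
        rw [h.radial_eq_zero hy hy0, h.radial_eq_zero hzV hz0]) (hv z hz 1 0)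
    rw [h.fderiv_radial hzV hz0 (hv z hz 1 0)] at h1
    have hpos := rho_pos (h.zval_lt_one z hzV)
    have hT := h.conormal_vecT_ne_zero hzV hz0
    have h2 : (3 - 2 * rho (zval z)) / rho (zval z) ^ 2 = 0 := by
      refine (mul_eq_zero.1 h1).resolve_right ?_
      simpa using hT
    have h3 := (div_eq_zero_iff.1 h2).resolve_right (by positivity)
    linarith
  obtain ⟨L, hL, hL'⟩ := hasFDerivAt_zval x
  have hzero : ∀ a b : ℝ, 2 * (x.1.1 * a - x.1.2 * b) = 0 := by
    intro a b
    have h1 := h.fderiv_eq_zero_of_const hx h0 (u := zval) (contDiff_zval (n := 1)).contDiffAt (by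
      filter_upwards [hρ, h.isOpen.mem_nhds hx] with z hz hzV hz0
      rw [← (rho_spec (h.zval_lt_one z hzV)).2, hz hz0, ← (rho_spec (h.zval_lt_one x hx)).2,
        (hρ.self_of_nhds h0)]) (hv x hy a b)
    rw [hL.fderiv, hL'] at h1
    exact h1
  have h1 := hzero 1 0
  have h2 := hzero 0 1
  apply h.ne_bifurcation x hx h0
  ext
  · simpa using h1
  · simpa using h2

/-- The hypersurface lies in the exterior region. -/
theorem sq_lt_sq (h : IsGeodesicConormal f n V) (hx : x ∈ V) (h0 : f x = 0) :
    x.1.1 ^ 2 < x.1.2 ^ 2 := by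
  have h1 := h.radial_eq_zero hx h0
  have h2 := h.timelike x hx h0
  have hT := h.conormal_vecT_ne_zero hx h0
  have hX : x.1.2 ≠ 0 := by
    intro hX
    rw [hX, zero_mul, add_zero] at h1
    have := (mul_eq_zero.1 h1).resolve_right hT
    exact h.ne_bifurcation x hx h0 (Prod.ext this hX)
  have h3 : x.1.1 ^ 2 * n x vecT ^ 2 = x.1.2 ^ 2 * n x vecX ^ 2 := by
    linear_combination (x.1.1 * n x vecT - x.1.2 * n x vecX) * h1
  have h4 : 0 < x.1.2 ^ 2 := by positivity
  have h5 : 0 < n x vecT ^ 2 := by positivity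
  by_contra! hle
  nlinarith [mul_lt_mul_of_pos_left h2 h4, mul_le_mul_of_nonneg_right hle h5.le]

/-- The ratio `T / X` is locally constant along the hypersurface. -/
theorem eventually_div_eq (h : IsGeodesicConormal f n V) (hx : x ∈ V) (h0 : f x = 0) :
    ∀ᶠ y in 𝓝 x, f y = 0 → y.1.1 / y.1.2 = x.1.1 / x.1.2 := by
  have hX : ∀ y ∈ V, f y = 0 → y.1.2 ≠ 0 := by
    intro y hy hy0 hX
    have := h.sq_lt_sq hy hy0
    rw [hX] at this
    nlinarith [sq_nonneg y.1.1]
  refine eventually_const_on_zeros (h := fun y : Coord => y.1.1 / y.1.2)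
    ((h.contDiffAt_fun x hx).of_le (by norm_num)) (ContDiffAt.div (by fun_prop) (by fun_prop)
      (hX x hx h0)) h0 (h.fderiv_ne_zero hx h0) ?_
  filter_upwards [h.isOpen.mem_nhds hx] with y hy hy0 v hv
  rw [h.fderiv_apply_eq_zero_iff hy, coord_decomp, h.angular_eq_zero hy hy0, add_zero] at hv
  have hXy := hX y hy hy0
  have hd : HasFDerivAt (fun y : Coord => y.1.1 * (y.1.2)⁻¹) _ y :=
    (hasFDerivAt_fst_fst y).mul
      ((hasDerivAt_inv hXy).comp_hasFDerivAt y (hasFDerivAt_fst_snd y))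
  have e := DFunLike.congr_fun hd.fderiv v
  simp only [div_eq_mul_inv]
  refine e.trans ?_
  have h1 := h.radial_eq_zero hy hy0
  have hT := h.conormal_vecT_ne_zero hy hy0
  simp
  field_simp
  -- With `σ = 0` and no angular part, `n` is proportional to `X dT - T dX`, which is `X²` times the
  -- differential of `T / X`.
  have : n y vecT * (y.1.2 * v.1.1 - y.1.1 * v.1.2) = 0 := by
    linear_combination y.1.2 * hv - v.1.2 * h1
  have := (mul_eq_zero.1 this).resolve_left hT
  linarith

end IsGeodesicConormal

end Kruskal

/-! ### The Koszul formula in a vector space -/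

section Koszul

variable {E : Type*} [NormedAddCommGroup E] [NormedSpace ℝ E]

theorem fderiv_clm_apply_apply {G : E → E →L[ℝ] E →L[ℝ] ℝ} {x : E} (hG : DifferentiableAt ℝ G x)
    {V W : E → E} (hV : DifferentiableAt ℝ V x) (hW : DifferentiableAt ℝ W x) (v : E) :
    fderiv ℝ (fun y => G y (V y) (W y)) x v
      = fderiv ℝ G x v (V x) (W x) + G x (fderiv ℝ V x v) (W x) + G x (V x) (fderiv ℝ W x v) := by
  rw [((hG.hasFDerivAt.clm_apply hV.hasFDerivAt).clm_apply hW.hasFDerivAt).fderiv]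
  simp
  ring

/-- The Koszul formula in a vector space, with two constant vector fields. -/
theorem leviCivitaInner_const {G : E → E →L[ℝ] E →L[ℝ] ℝ} {N : E → E} {x : E}
    (hG : DifferentiableAt ℝ G x) (hN : DifferentiableAt ℝ N x)
    (hsymm : ∀ v w, G x v w = G x w v) (a b : E) :
    leviCivitaInner 𝓘(ℝ, E) (fun p v w => G p v w) (fun _ => a) N (fun _ => b) x
      = fderiv ℝ (fun y => G y (N y)) x a b
        - (fderiv ℝ G x a (N x) b + fderiv ℝ G x b a (N x) - fderiv ℝ G x (N x) a b) / 2 := by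
  have e (u : E → ℝ) (v : E) : differential 𝓘(ℝ, E) u x v = fderiv ℝ u x v := by
    unfold differential
    rw [mfderiv_eq_fderiv]
    rfl
  have eb (V W : ∀ y : E, TangentSpace 𝓘(ℝ, E) y) : VectorField.mlieBracket 𝓘(ℝ, E) V W x
      = VectorField.lieBracket ℝ (fun y => (V y : E)) (fun y => (W y : E)) x := by
    rw [← VectorField.mlieBracketWithin_univ, VectorField.mlieBracketWithin_eq_lieBracketWithin]
    exact congrFun (VectorField.lieBracketWithin_univ (𝕜 := ℝ) (V := fun y => (V y : E))
      (W := fun y => (W y : E))) x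
  have hc (c : E) : DifferentiableAt ℝ (fun _ : E => c) x := differentiableAt_const c
  unfold leviCivitaInner
  have h1 := e (fun q => G q (N q) b) a
  have h2 := e (fun q => G q a b) (N x)
  have h3 := e (fun q => G q a (N q)) b
  rw [fderiv_clm_apply_apply hG hN (hc b)] at h1
  rw [fderiv_clm_apply_apply hG (hc a) (hc b)] at h2
  rw [fderiv_clm_apply_apply hG (hc a) hN] at h3
  -- For constant `a`, `b` the brackets are `DN(a)`, `0` and `-DN(b)`; the terms in `DN(b)` cancel
  -- by symmetry of the metric.
  have b1 := eb (fun _ => a) N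
  have b2 := eb (fun _ => a) (fun _ => b)
  have b3 := eb N (fun _ => b)
  simp only [VectorField.lieBracket] at b1 b2 b3
  erw [h1, h2, h3, b1, b2, b3]
  rw [(hG.hasFDerivAt.clm_apply hN.hasFDerivAt).fderiv]
  simp [hsymm a]
  rw [hsymm (fderiv ℝ N x b) a]
  ring

end Koszul

/-! ### Lorentzian linear algebra -/

section Lorentz

variable {E : Type*} [NormedAddCommGroup E] [NormedSpace ℝ E]

/-- The normal of a spacelike hyperplane is timelike. -/
theorem apply_normal_neg {G : E →L[ℝ] E →L[ℝ] ℝ} (hsymm : ∀ v w, G v w = G w v) {ν τ : E}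
    (hν : ν ≠ 0) (hτ : G τ τ < 0) (hpos : ∀ v, G ν v = 0 → v ≠ 0 → 0 < G v v) : G ν ν < 0 := by
  by_contra! h
  rcases h.eq_or_lt with h0 | h0
  -- A null `ν` would lie in its own orthogonal hyperplane, where `G` is positive.
  · exact absurd (hpos ν h0.symm hν) (by rw [← h0]; exact lt_irrefl _)
  -- A spacelike `ν` would split the space orthogonally into two nonnegative parts, leaving no room
  -- for `τ`.
  · set w := τ - (G ν τ / G ν ν) • ν with hw
    have h1 : G ν w = 0 := by
      simp only [hw, map_sub, map_smul, smul_eq_mul]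
      field_simp
      ring
    have h2 : 0 ≤ G w w := by
      rcases eq_or_ne w 0 with h | h
      · simp [h]
      · exact (hpos w h1 h).le
    have h3 : τ = w + (G ν τ / G ν ν) • ν := by simp [hw]
    have h4 : G τ τ = G w w + (G ν τ / G ν ν) ^ 2 * G ν ν := by
      conv_lhs => rw [h3]
      simp only [map_add, add_apply, map_smul, smul_apply,
        smul_eq_mul, h1, hsymm w ν]
      ring
    nlinarith [sq_nonneg (G ν τ / G ν ν)]

variable [FiniteDimensional ℝ E]

theorem isInvertible_of_nondegenerate {G : E →L[ℝ] E →L[ℝ] ℝ}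
    (hG : ∀ v, (∀ w, G v w = 0) → v = 0) : G.IsInvertible := by
  have hinj : Function.Injective (G : E →ₗ[ℝ] (E →L[ℝ] ℝ)) := by
    rw [← LinearMap.ker_eq_bot, LinearMap.ker_eq_bot']
    intro v hv
    exact hG v fun w => DFunLike.congr_fun hv w
  have hdim : Module.finrank ℝ E = Module.finrank ℝ (E →L[ℝ] ℝ) := by
    rw [← (LinearMap.toContinuousLinearMap : (E →ₗ[ℝ] ℝ) ≃ₗ[ℝ] _).finrank_eq]
    exact (Subspace.dual_finrank_eq (K := ℝ) (V := E)).symm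
  let e := LinearEquiv.ofInjectiveOfFinrankEq (G : E →ₗ[ℝ] (E →L[ℝ] ℝ)) hinj hdim
  exact ⟨e.toContinuousLinearEquiv, ContinuousLinearMap.ext fun v => rfl⟩

end Lorentz

/-! ### Transport of fields, brackets and connection to a chart -/

section Chart

open Filter

variable {E H M : Type*} [NormedAddCommGroup E] [NormedSpace ℝ E]
    [TopologicalSpace H] {I : ModelWithCorners ℝ E H}
    [TopologicalSpace M] [ChartedSpace H M]

/-- The vector field on a manifold with a given expression in the chart at `p`. -/
def chartField (I : ModelWithCorners ℝ E H) (p : M) (V : E → E) (q : M) : TangentSpace I q :=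
  VectorField.mpullback I 𝓘(ℝ, E) (extChartAt I p) (fun x => (V x : TangentSpace 𝓘(ℝ, E) x)) q

variable {p q : M}

variable [IsManifold I ω M]

theorem mfderiv_extChartAt_chartField (hq : q ∈ (extChartAt I p).source) (V : E → E) :
    mfderiv I 𝓘(ℝ, E) (extChartAt I p) q (chartField I p V q) = V (extChartAt I p q) := by
  obtain ⟨L, hL⟩ := isInvertible_mfderiv_extChartAt (I := I) hq
  unfold chartField VectorField.mpullback
  rw [← hL, ContinuousLinearMap.inverse_equiv]
  exact L.apply_symm_apply _

theorem contMDiffAt_extChartAt_of_mem (hq : q ∈ (extChartAt I p).source) {n : WithTop ℕ∞} :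
    ContMDiffAt I 𝓘(ℝ, E) n (extChartAt I p) q :=
  (contMDiffAt_extChartAt' (n := ω) (by rwa [← extChartAt_source I])).of_le le_top

theorem isC1FieldAt_chartField [CompleteSpace E] (hq : q ∈ (extChartAt I p).source) {V : E → E}
    (hV : ContDiffAt ℝ 1 V (extChartAt I p q)) : IsC1FieldAt I (chartField I p V) q := by
  refine ContMDiffAt.mpullback_vectorField_preimage (I' := 𝓘(ℝ, E)) (n := 2) ?_
    (contMDiffAt_extChartAt_of_mem hq) (isInvertible_mfderiv_extChartAt hq) (by norm_num)
  exact contMDiffAt_vectorSpace_iff_contDiffAt.2 hV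

theorem mfderiv_apply_of_chart {F : Type*} [NormedAddCommGroup F] [NormedSpace ℝ F]
    (hq : q ∈ (extChartAt I p).source) {u : M → F} {U : E → F}
    (hu : u =ᶠ[𝓝 q] U ∘ extChartAt I p) (hU : DifferentiableAt ℝ U (extChartAt I p q))
    (v : TangentSpace I q) : mfderiv I 𝓘(ℝ, F) u q v
      = fderiv ℝ U (extChartAt I p q) (mfderiv I 𝓘(ℝ, E) (extChartAt I p) q v) := by
  have h1 : MDifferentiableAt I 𝓘(ℝ, E) (extChartAt I p) q :=
    (contMDiffAt_extChartAt_of_mem (n := 1) hq).mdifferentiableAt one_ne_zero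
  have h2 : HasMFDerivAt I 𝓘(ℝ, F) (U ∘ extChartAt I p) q
      ((fderiv ℝ U (extChartAt I p q)).comp (mfderiv I 𝓘(ℝ, E) (extChartAt I p) q)) :=
    HasMFDerivAt.comp q hU.hasFDerivAt.hasMFDerivAt h1.hasMFDerivAt
  have h3 := (h2.congr_of_eventuallyEq hu).mfderiv
  rw [h3]
  rfl

theorem differential_chartField (hq : q ∈ (extChartAt I p).source) {u : M → ℝ} {U : E → ℝ}
    (hu : u =ᶠ[𝓝 q] U ∘ extChartAt I p) (hU : DifferentiableAt ℝ U (extChartAt I p q))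
    (v : TangentSpace I q) : differential I u q v
      = fderiv ℝ U (extChartAt I p q) (mfderiv I 𝓘(ℝ, E) (extChartAt I p) q v) :=
  mfderiv_apply_of_chart hq hu hU v

theorem mlieBracket_chartField [CompleteSpace E] (hq : q ∈ (extChartAt I p).source) {V W : E → E}
    (hV : ContDiffAt ℝ 1 V (extChartAt I p q)) (hW : ContDiffAt ℝ 1 W (extChartAt I p q)) :
    VectorField.mlieBracket I (chartField I p V) (chartField I p W) q
      = chartField I p (fun x => VectorField.mlieBracket 𝓘(ℝ, E)
          (fun x => (V x : TangentSpace 𝓘(ℝ, E) x)) (fun x => (W x : TangentSpace 𝓘(ℝ, E) x)) x)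
          q := by
  have : IsManifold I (minSmoothness ℝ 2) M := inferInstance
  refine (VectorField.mpullback_mlieBracket (n := ω) ?_ ?_
    (contMDiffAt_extChartAt_of_mem hq) le_top).symm
  · exact (contMDiffAt_vectorSpace_iff_contDiffAt.2 hV).mdifferentiableAt one_ne_zero
  · exact (contMDiffAt_vectorSpace_iff_contDiffAt.2 hW).mdifferentiableAt one_ne_zero

/-- The expression of a metric tensor in the chart at `p`. -/
def IsChartMetric (I : ModelWithCorners ℝ E H) (g : ∀ p : M, TangentSpace I p → TangentSpace I p → ℝ)
    (p : M) (G : E → E →L[ℝ] E →L[ℝ] ℝ) : Prop :=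
  ∀ q ∈ (extChartAt I p).source, ∀ v w : TangentSpace I q,
    g q v w = G (extChartAt I p q) (mfderiv I 𝓘(ℝ, E) (extChartAt I p) q v)
      (mfderiv I 𝓘(ℝ, E) (extChartAt I p) q w)

variable {g : ∀ p : M, TangentSpace I p → TangentSpace I p → ℝ} {G : E → E →L[ℝ] E →L[ℝ] ℝ}

theorem IsChartMetric.apply_chartField (h : IsChartMetric I g p G)
    (hq : q ∈ (extChartAt I p).source) (V W : E → E) :
    g q (chartField I p V q) (chartField I p W q)
      = G (extChartAt I p q) (V (extChartAt I p q)) (W (extChartAt I p q)) := by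
  rw [h q hq]
  congr 1
  · congr 1
    exact mfderiv_extChartAt_chartField hq V
  · exact mfderiv_extChartAt_chartField hq W

/-- The Koszul formula involves only differentials of functions, values of the metric and Lie
brackets, and each of these is natural under pullback by the chart. -/
theorem leviCivitaInner_chartField [CompleteSpace E] (h : IsChartMetric I g p G)
    (hq : q ∈ (extChartAt I p).source) (hG : DifferentiableAt ℝ G (extChartAt I p q))
    {V N W : E → E} (hV : ContDiffAt ℝ 1 V (extChartAt I p q))
    (hN : ContDiffAt ℝ 1 N (extChartAt I p q)) (hW : ContDiffAt ℝ 1 W (extChartAt I p q)) :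
    leviCivitaInner I g (chartField I p V) (chartField I p N) (chartField I p W) q
      = leviCivitaInner 𝓘(ℝ, E) (fun x v w => G x v w) V N W (extChartAt I p q) := by
  have hD {A B C : E → E} (hA : ContDiffAt ℝ 1 A (extChartAt I p q))
      (hB : ContDiffAt ℝ 1 B (extChartAt I p q)) :
      differential I (fun q => g q (chartField I p A q) (chartField I p B q)) q
          (chartField I p C q)
        = differential 𝓘(ℝ, E) (fun x => G x (A x) (B x)) (extChartAt I p q)
          (C (extChartAt I p q)) := by
    have hU : DifferentiableAt ℝ (fun x => G x (A x) (B x)) (extChartAt I p q) :=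
      (hG.clm_apply (hA.differentiableAt one_ne_zero)).clm_apply (hB.differentiableAt one_ne_zero)
    rw [differential_chartField (p := p) hq (U := fun x => G x (A x) (B x)) ?_ hU]
    · unfold differential
      rw [mfderiv_eq_fderiv]
      congr 1
      exact mfderiv_extChartAt_chartField hq C
    · filter_upwards [(isOpen_extChartAt_source p).mem_nhds hq] with q' hq'
      exact h.apply_chartField hq' A B
  unfold leviCivitaInner
  rw [hD hN hW, hD hV hW, hD hV hN, mlieBracket_chartField hq hV hN,
    mlieBracket_chartField hq hV hW, mlieBracket_chartField hq hN hW]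
  have hb (A B C : E → E) := h.apply_chartField hq
    (fun x => VectorField.mlieBracket 𝓘(ℝ, E) (fun x => (A x : TangentSpace 𝓘(ℝ, E) x))
      (fun x => (B x : TangentSpace 𝓘(ℝ, E) x)) x) C
  erw [hb V N W, hb V W N, hb N W V]

end Chart

/-! ### The unit normal of a family of level sets -/

section UnitNormal

variable {E : Type*} [NormedAddCommGroup E] [NormedSpace ℝ E]

/-- The unit conormal `n` and unit normal `N` of the level sets of a function with timelike
gradient. -/
theorem exists_unit_normal [FiniteDimensional ℝ E] {G : E → E →L[ℝ] E →L[ℝ] ℝ} {f : E → ℝ} {U : Set E} {x₀ : E}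
    (hU : IsOpen U) (hG : ∀ x ∈ U, ContDiffAt ℝ 2 G x) (hinv : ∀ x ∈ U, (G x).IsInvertible)
    (hsymm : ∀ x ∈ U, ∀ v w, G x v w = G x w v) (hf : ∀ x ∈ U, ContDiffAt ℝ 3 f x)
    (hx₀ : x₀ ∈ U) (hτ : ∃ τ, G x₀ τ τ < 0) (hdf : fderiv ℝ f x₀ ≠ 0)
    (hpos : ∀ v, fderiv ℝ f x₀ v = 0 → v ≠ 0 → 0 < G x₀ v v) :
    ∃ (V : Set E) (n : E → E →L[ℝ] ℝ) (N : E → E), V ⊆ U ∧ IsOpen V ∧ x₀ ∈ V ∧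
      (∀ x ∈ V, ContDiffAt ℝ 2 n x) ∧ (∀ x ∈ V, ContDiffAt ℝ 2 N x) ∧
      (∀ x ∈ V, ∃ c : ℝ, c ≠ 0 ∧ n x = c • fderiv ℝ f x) ∧
      (∀ x ∈ V, n x (N x) = -1) ∧ ∀ x ∈ V, n x = G x (N x) := by
  have hDf : ∀ x ∈ U, ContDiffAt ℝ 2 (fderiv ℝ f) x := fun x hx =>
    (hf x hx).fderiv_right (m := 2) (by norm_num)
  set ν : E → E := fun x => (G x).inverse (fderiv ℝ f x) with hν
  have hνC : ∀ x ∈ U, ContDiffAt ℝ 2 ν x := fun x hx =>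
    ((hinv x hx).contDiffAt_map_inverse.comp x (hG x hx)).clm_apply (hDf x hx)
  have hGν : ∀ x ∈ U, G x (ν x) = fderiv ℝ f x := fun x hx => (hinv x hx).self_apply_inverse _
  set q : E → ℝ := fun x => -fderiv ℝ f x (ν x) with hq
  have hqC : ∀ x ∈ U, ContDiffAt ℝ 2 q x := fun x hx => ((hDf x hx).clm_apply (hνC x hx)).neg
  have hq0 : 0 < q x₀ := by
    obtain ⟨τ, hτ⟩ := hτ
    have hν0 : ν x₀ ≠ 0 := by
      intro h0
      have := hGν x₀ hx₀
      rw [h0, map_zero] at this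
      exact hdf this.symm
    have := apply_normal_neg (hsymm x₀ hx₀) hν0 hτ (fun v hv => hpos v (by rwa [← hGν x₀ hx₀]))
    rw [hGν x₀ hx₀] at this
    exact neg_pos.2 this
  -- Here `ν` is the gradient of `f` and `q` is minus its squared length. On the open set where `q`
  -- is positive all level sets of `f` are spacelike, so the normal is normalized off the zero set
  -- as well.
  set V : Set E := U ∩ q ⁻¹' Set.Ioi 0 with hV
  have hcq : ContinuousOn q U := fun x hx => (hqC x hx).continuousAt.continuousWithinAt
  have hlC : ∀ x ∈ V, ContDiffAt ℝ 2 (fun x => (Real.sqrt (q x))⁻¹) x := fun x hx =>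
    ((hqC x hx.1).sqrt hx.2.ne').inv (Real.sqrt_pos.2 hx.2).ne'
  refine ⟨V, fun x => (Real.sqrt (q x))⁻¹ • fderiv ℝ f x, fun x => (Real.sqrt (q x))⁻¹ • ν x,
    Set.inter_subset_left, hcq.isOpen_inter_preimage hU isOpen_Ioi, ⟨hx₀, hq0⟩,
    fun x hx => (hlC x hx).smul (hDf x hx.1), fun x hx => (hlC x hx).smul (hνC x hx.1),
    fun x hx => ⟨_, inv_ne_zero (Real.sqrt_pos.2 hx.2).ne', rfl⟩, fun x hx => ?_, fun x hx => ?_⟩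
  · have h1 : fderiv ℝ f x (ν x) = -q x := by simp [hq]
    have h2 := Real.sqrt_pos.2 hx.2
    have h3 := Real.mul_self_sqrt hx.2.le
    simp only [smul_apply, map_smul, smul_eq_mul, h1]
    field_simp
    linarith
  · rw [map_smul, hGν x hx.1]

/-- If the unit normal is parallel in tangential directions when tested against tangential
vectors, then it is parallel in tangential directions. -/
theorem fderiv_conormal_of_tangential {G : E → E →L[ℝ] E →L[ℝ] ℝ} {n : E → E →L[ℝ] ℝ} {N : E → E}
    {V : Set E} {x : E} (hV : V ∈ 𝓝 x) (hG : DifferentiableAt ℝ G x)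
    (hsymm : ∀ y ∈ V, ∀ v w, G y v w = G y w v) (hN : DifferentiableAt ℝ N x)
    (hnN : ∀ y ∈ V, n y (N y) = -1) (hGN : ∀ y ∈ V, n y = G y (N y)) {a : E}
    (h : ∀ b, n x b = 0 → fderiv ℝ (fun y => G y (N y)) x a b
      = (fderiv ℝ G x a (N x) b + fderiv ℝ G x b a (N x) - fderiv ℝ G x (N x) a b) / 2) (b : E) :
    fderiv ℝ n x a b
      = (fderiv ℝ G x a (N x) b + fderiv ℝ G x b a (N x) - fderiv ℝ G x (N x) a b) / 2 := by
  have hxV := mem_of_mem_nhds hV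
  have heq : n =ᶠ[𝓝 x] fun y => G y (N y) := by
    filter_upwards [hV] with y hy using hGN y hy
  rw [← heq.fderiv_eq] at h
  -- The component along the normal itself is not part of the hypothesis; it comes from
  -- differentiating `g(N, N) = -1`.
  have hN' : fderiv ℝ n x a (N x)
      = (fderiv ℝ G x a (N x) (N x) + fderiv ℝ G x (N x) a (N x) - fderiv ℝ G x (N x) a (N x)) / 2
      := by
    have h1 : fderiv ℝ (fun y => G y (N y) (N y)) x a = 0 := by
      have : (fun y => G y (N y) (N y)) =ᶠ[𝓝 x] fun _ => -1 := by
        filter_upwards [hV] with y hy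
        rw [← hGN y hy, hnN y hy]
      rw [this.fderiv_eq]
      simp
    rw [fderiv_clm_apply_apply hG hN hN] at h1
    have h2 : fderiv ℝ n x a (N x) = fderiv ℝ G x a (N x) (N x) + G x (fderiv ℝ N x a) (N x) := by
      rw [heq.fderiv_eq, (hG.hasFDerivAt.clm_apply hN.hasFDerivAt).fderiv]
      simp
      ring
    rw [hsymm x hxV (N x)] at h1
    linarith
  -- Since `n(N) = -1`, this corrects `b` to a tangential vector.
  have hb : n x (b + n x b • N x) = 0 := by
    simp [hnN x hxV]
  have h1 := h _ hb
  simp only [map_add, map_smul, add_apply, smul_apply, smul_eq_mul] at h1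
  linear_combination h1 - n x b * hN'

end UnitNormal

/-! ### Time-symmetric hypersurfaces in a chart -/

section Hypersurface

open Filter

variable {E H M : Type*} [NormedAddCommGroup E] [NormedSpace ℝ E]
    [TopologicalSpace H] {I : ModelWithCorners ℝ E H}
    [TopologicalSpace M] [ChartedSpace H M] [IsManifold I ω M]
    {p q : M} {S : Set M} {f : E → ℝ}

theorem contDiffAt_comp_extChartAt_symm [I.Boundaryless] {x : E}
    (hx : x ∈ (extChartAt I p).target) {n : WithTop ℕ∞} {u : M → ℝ}
    (hu : ContMDiffAt I 𝓘(ℝ, ℝ) n u ((extChartAt I p).symm x)) :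
    ContDiffAt ℝ n (fun y => u ((extChartAt I p).symm y)) x := by
  have h1 : ContMDiffAt 𝓘(ℝ, E) I n (extChartAt I p).symm x :=
    ((contMDiffOn_extChartAt_symm (n := ω) p).contMDiffAt
      ((isOpen_extChartAt_target p).mem_nhds hx)).of_le le_top
  exact contMDiffAt_iff_contDiffAt.1 (hu.comp x h1)

/-- A hypersurface is given in a chart by a function with nonvanishing differential. -/
theorem IsEmbeddedHypersurface.exists_chart_function [I.Boundaryless] {k : WithTop ℕ∞}
    (hS : IsEmbeddedHypersurface I k S) (hp : p ∈ S) :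
    ∃ (U : Set E) (f : E → ℝ), IsOpen U ∧ U ⊆ (extChartAt I p).target ∧ extChartAt I p p ∈ U ∧
      (∀ x ∈ U, ContDiffAt ℝ k f x) ∧ (∀ x ∈ U, fderiv ℝ f x ≠ 0) ∧
      ∀ x ∈ U, (extChartAt I p).symm x ∈ S ↔ f x = 0 := by
  obtain ⟨W, u, hW, hpW, huC, hdu, hSu⟩ := hS p hp
  have hU := (continuousOn_extChartAt_symm (I := I) p).isOpen_inter_preimage
    (isOpen_extChartAt_target p) hW
  refine ⟨_, fun y => u ((extChartAt I p).symm y), hU, Set.inter_subset_left,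
    ⟨mem_extChartAt_target p, by simpa using hpW⟩, fun x hx => ?_, fun x hx h0 => ?_,
    fun x hx => hSu _ hx.2⟩
  · exact contDiffAt_comp_extChartAt_symm hx.1 (huC.contMDiffAt (hW.mem_nhds hx.2))
  · apply hdu _ hx.2
    set q := (extChartAt I p).symm x with hq
    have hqs : q ∈ (extChartAt I p).source := (extChartAt I p).map_target hx.1
    have hqx : extChartAt I p q = x := (extChartAt I p).right_inv hx.1
    -- The derivative is zero by convention at points of non-differentiability, so its nonvanishing
    -- already contains differentiability.
    have hmd : MDifferentiableAt I 𝓘(ℝ, ℝ) u q := by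
      by_contra hnot
      exact hdu _ hx.2 (mfderiv_zero_of_not_mdifferentiableAt hnot)
    have hsymmd : MDifferentiableAt 𝓘(ℝ, E) I (extChartAt I p).symm x :=
      (((contMDiffOn_extChartAt_symm (n := ω) p).contMDiffAt
        ((isOpen_extChartAt_target p).mem_nhds hx.1))).mdifferentiableAt (by simp)
    have hd : DifferentiableAt ℝ (fun y => u ((extChartAt I p).symm y)) x :=
      (hmd.comp x hsymmd).differentiableAt
    refine ContinuousLinearMap.ext fun v => ?_
    have := differential_chartField (I := I) (p := p) hqs (u := u)
      (U := fun y => u ((extChartAt I p).symm y)) ?_ (by rwa [hqx]) v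
    · rw [hqx, h0] at this
      exact this
    · filter_upwards [(isOpen_extChartAt_source p).mem_nhds hqs] with q' hq'
      simp only [Function.comp_apply, (extChartAt I p).left_inv hq']

/-- Vectors annihilated by the differential of the defining function in a chart are tangent. -/
theorem mem_submanifoldTangentSpace_of_fderiv [CompleteSpace E] [I.Boundaryless] {U : Set E} (hU : IsOpen U)
    (hq : q ∈ (extChartAt I p).source) (hqU : extChartAt I p q ∈ U) (hqS : q ∈ S)
    (hUt : U ⊆ (extChartAt I p).target)
    (hf : ContDiffAt ℝ 1 f (extChartAt I p q)) (hdf : fderiv ℝ f (extChartAt I p q) ≠ 0)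
    (hSf : ∀ x ∈ U, (extChartAt I p).symm x ∈ S ↔ f x = 0) {v : TangentSpace I q}
    (hv : fderiv ℝ f (extChartAt I p q) (mfderiv I 𝓘(ℝ, E) (extChartAt I p) q v) = 0) :
    v ∈ submanifoldTangentSpace I S q := by
  intro h hh h0
  set x := extChartAt I p q with hx
  have hxq : (extChartAt I p).symm x = q := (extChartAt I p).left_inv hq
  have hC : ContDiffAt ℝ 1 (fun y => h ((extChartAt I p).symm y)) x :=
    contDiffAt_comp_extChartAt_symm (hUt hqU) (by rwa [hxq])
  rw [differential_chartField (I := I) (p := p) hq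
    (U := fun y => h ((extChartAt I p).symm y)) ?_ (hC.differentiableAt one_ne_zero)]
  · refine fderiv_apply_eq_zero_of_const_on_zeros hf hC ?_ hdf ?_ hv
    · rwa [← hSf x hqU, hxq]
    · have hcont : ContinuousAt (extChartAt I p).symm x := continuousAt_extChartAt_symm' hq
      rw [eventually_nhdsWithin_iff] at h0
      rw [ContinuousAt, hxq] at hcont
      have hhq : h q = 0 := h0.self_of_nhds hqS
      filter_upwards [hcont.eventually h0, hU.mem_nhds hqU] with y hy hyU hfy
      rw [hy ((hSf y hyU).2 hfy), hxq, hhq]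
  · filter_upwards [(isOpen_extChartAt_source p).mem_nhds hq] with q' hq'
    simp only [Function.comp_apply, (extChartAt I p).left_inv hq']

/-- Tangent vectors are annihilated by the differential of the defining function in a chart. -/
theorem fderiv_eq_zero_of_mem_submanifoldTangentSpace {U : Set E} (hU : IsOpen U)
    (hq : q ∈ (extChartAt I p).source) (hqU : extChartAt I p q ∈ U)
    (hf : ContDiffAt ℝ 1 f (extChartAt I p q))
    (hSf : ∀ x ∈ U, (extChartAt I p).symm x ∈ S ↔ f x = 0) {v : TangentSpace I q}
    (hv : v ∈ submanifoldTangentSpace I S q) :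
    fderiv ℝ f (extChartAt I p q) (mfderiv I 𝓘(ℝ, E) (extChartAt I p) q v) = 0 := by
  have hC : ContMDiffAt I 𝓘(ℝ, ℝ) 1 (f ∘ extChartAt I p) q :=
    (contMDiffAt_iff_contDiffAt.2 hf).comp q (contMDiffAt_extChartAt_of_mem hq)
  have h0 : ∀ᶠ q' in 𝓝[S] q, (f ∘ extChartAt I p) q' = 0 := by
    rw [eventually_nhdsWithin_iff]
    filter_upwards [(isOpen_extChartAt_source p).mem_nhds hq,
      (continuousAt_extChartAt' hq).eventually (hU.mem_nhds hqU)] with q' hq' hqU' hqS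
    exact (hSf _ hqU').1 (by rwa [(extChartAt I p).left_inv hq'])
  have := hv _ hC h0
  rwa [differential_chartField (I := I) (p := p) hq (U := f) (Eventually.of_forall fun _ => rfl)
    (hf.differentiableAt one_ne_zero)] at this

variable {g : ∀ p : M, TangentSpace I p → TangentSpace I p → ℝ} {G : E → E →L[ℝ] E →L[ℝ] ℝ}

/-- A spacelike time-symmetric hypersurface is described in a chart by a defining function whose
unit conormal is parallel along the hypersurface. -/
theorem exists_parallel_conormal [FiniteDimensional ℝ E] [I.Boundaryless] (hS : IsEmbeddedHypersurface I 3 S)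
    (hspace : IsSpacelike I g S) (htime : IsTimeSymmetric I g S) (hp : p ∈ S)
    (hchart : IsChartMetric I g p G)
    (hG : ∀ x ∈ (extChartAt I p).target, ContDiffAt ℝ 2 G x)
    (hnondeg : ∀ x ∈ (extChartAt I p).target, ∀ v, (∀ w, G x v w = 0) → v = 0)
    (hsymm : ∀ x ∈ (extChartAt I p).target, ∀ v w, G x v w = G x w v)
    (hτ : ∀ x ∈ (extChartAt I p).target, ∃ τ, G x τ τ < 0) :
    ∃ (V : Set E) (f : E → ℝ) (n : E → E →L[ℝ] ℝ) (N : E → E),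
      IsOpen V ∧ V ⊆ (extChartAt I p).target ∧ extChartAt I p p ∈ V ∧
      (∀ x ∈ V, (extChartAt I p).symm x ∈ S ↔ f x = 0) ∧
      (∀ x ∈ V, ContDiffAt ℝ 2 f x) ∧ (∀ x ∈ V, ContDiffAt ℝ 2 n x) ∧
      (∀ x ∈ V, ∃ c : ℝ, c ≠ 0 ∧ n x = c • fderiv ℝ f x) ∧
      (∀ x ∈ V, n x (N x) = -1) ∧ (∀ x ∈ V, n x = G x (N x)) ∧
      ∀ x ∈ V, f x = 0 → ∀ a, n x a = 0 → ∀ b, fderiv ℝ n x a b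
        = (fderiv ℝ G x a (N x) b + fderiv ℝ G x b a (N x) - fderiv ℝ G x (N x) a b) / 2 := by
  have : CompleteSpace E := FiniteDimensional.complete ℝ E
  obtain ⟨U, f, hU, hUt, hpU, hf, hdf, hSf⟩ := hS.exists_chart_function hp
  have hps := mem_extChartAt_source (I := I) p
  have htan : ∀ q ∈ (extChartAt I p).source, extChartAt I p q ∈ U → q ∈ S → ∀ a,
      fderiv ℝ f (extChartAt I p q) a = 0 →
      chartField I p (fun _ => a) q ∈ submanifoldTangentSpace I S q := by
    intro q hq hqU hqS a ha
    refine mem_submanifoldTangentSpace_of_fderiv hU hq hqU hqS hUt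
      ((hf _ hqU).of_le (by norm_num)) (hdf _ hqU) hSf ?_
    refine Eq.trans ?_ ha
    exact congrArg _ (mfderiv_extChartAt_chartField hq _)
  obtain ⟨V, n, N, hVU, hV, hpV, hn, hN, hnf, hnN, hGN⟩ := exists_unit_normal hU
    (fun x hx => hG x (hUt hx)) (fun x hx => isInvertible_of_nondegenerate (hnondeg x (hUt hx)))
    (fun x hx => hsymm x (hUt hx)) hf hpU (hτ _ (hUt hpU)) (hdf _ hpU) (fun v hv hv0 => by
      have h1 := hspace p hp _ (htan p hps hpU hp v hv) (by
        intro h0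
        have h2 := mfderiv_extChartAt_chartField (I := I) hps (fun _ => v)
        rw [h0, map_zero] at h2
        exact hv0 h2.symm)
      rwa [hchart.apply_chartField hps] at h1)
  refine ⟨V, f, n, N, hV, hVU.trans hUt, hpV, fun x hx => hSf x (hVU hx),
    fun x hx => (hf x (hVU hx)).of_le (by norm_num), hn, hnf, hnN, hGN, ?_⟩
  intro x hx h0 a ha
  have hGx := (hG x (hUt (hVU hx))).differentiableAt two_ne_zero
  have hNx := (hN x hx).differentiableAt two_ne_zero
  refine fderiv_conormal_of_tangential (hV.mem_nhds hx) hGx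
    (fun y hy => hsymm y (hUt (hVU hy))) hNx hnN hGN ?_
  intro b hb
  have hker : ∀ v, n x v = 0 → fderiv ℝ f x v = 0 := by
    intro v hv
    obtain ⟨c, hc, hnc⟩ := hnf x hx
    rw [hnc] at hv
    simpa [hc] using hv
  obtain ⟨q, hq, rfl⟩ : ∃ q ∈ (extChartAt I p).source, extChartAt I p q = x :=
    ⟨_, (extChartAt I p).map_target (hUt (hVU hx)), (extChartAt I p).right_inv (hUt (hVU hx))⟩
  have hqS : q ∈ S := by
    have := (hSf _ (hVU hx)).2 h0
    rwa [(extChartAt I p).left_inv hq] at this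
  have hunit : IsUnitNormalNear I g S (chartField I p N) q := by
    refine ⟨isC1FieldAt_chartField hq ((hN _ hx).of_le (by norm_num)), ?_⟩
    rw [eventually_nhdsWithin_iff]
    filter_upwards [(isOpen_extChartAt_source p).mem_nhds hq,
      (continuousAt_extChartAt' hq).eventually (hV.mem_nhds hx)] with q' hq' hqV' hqS'
    refine ⟨?_, fun v hv => ?_⟩
    · rw [hchart.apply_chartField hq', ← hGN _ hqV', hnN _ hqV']
    · rw [hchart q' hq']
      have h1 := fderiv_eq_zero_of_mem_submanifoldTangentSpace hU hq' (hVU hqV')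
        ((hf _ (hVU hqV')).of_le (by norm_num)) hSf hv
      obtain ⟨c, hc, hnc⟩ := hnf _ hqV'
      have h2 := mfderiv_extChartAt_chartField (I := I) hq' N
      have h3 : G (extChartAt I p q') (N (extChartAt I p q'))
          (mfderiv I 𝓘(ℝ, E) (extChartAt I p) q' v) = 0 := by
        rw [← hGN _ hqV', hnc]
        exact (congrArg (fun t : ℝ => c * t) h1).trans (mul_zero c)
      refine Eq.trans ?_ h3
      exact congrArg (fun w : E => G (extChartAt I p q') w
        (mfderiv I 𝓘(ℝ, E) (extChartAt I p) q' v)) h2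
  -- Fields constant in the chart are enough as test fields: the curvature condition then becomes
  -- the Christoffel formula for tangential `a` and `b`.
  have hK := htime q hqS (chartField I p N) (chartField I p fun _ => a) (chartField I p fun _ => b)
    hunit (isC1FieldAt_chartField hq contDiffAt_const) (isC1FieldAt_chartField hq contDiffAt_const)
    (htan q hq (hVU hx) hqS a (hker a ha)) (htan q hq (hVU hx) hqS b (hker b hb))
  unfold extrinsicCurvature at hK
  rw [leviCivitaInner_chartField hchart hq hGx contDiffAt_const
    ((hN _ hx).of_le (by norm_num)) contDiffAt_const,
    leviCivitaInner_const hGx hNx (hsymm _ (hUt (hVU hx)))] at hK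
  linarith

end Hypersurface

/-! ### The Kruskal metric in a chart -/

namespace Kruskal

open Filter

/-- The inclusion of the sphere into space, in the chart at a point of the sphere. -/
def sphereChartInv (ξ : Sphere2) (y : EuclideanSpace ℝ (Fin 2)) : Space3 :=
  ((extChartAt (𝓡 2) ξ).symm y : Sphere2)

theorem contMDiffAt_extChartAt_symm_sphere {ξ : Sphere2} {y : EuclideanSpace ℝ (Fin 2)}
    (hy : y ∈ (extChartAt (𝓡 2) ξ).target) :
    ContMDiffAt 𝓘(ℝ, EuclideanSpace ℝ (Fin 2)) (𝓡 2) ω (extChartAt (𝓡 2) ξ).symm y :=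
  (contMDiffOn_extChartAt_symm (n := ω) ξ).contMDiffAt ((isOpen_extChartAt_target ξ).mem_nhds hy)

theorem contDiffAt_sphereChartInv {ξ : Sphere2} {y : EuclideanSpace ℝ (Fin 2)}
    (hy : y ∈ (extChartAt (𝓡 2) ξ).target) : ContDiffAt ℝ ω (sphereChartInv ξ) y := by
  have h1 : ContMDiff (𝓡 2) 𝓘(ℝ, Space3) ω (fun x : Sphere2 => (x : Space3)) :=
    contMDiff_coe_sphere
  exact contMDiffAt_iff_contDiffAt.1
    (h1.contMDiffAt.comp y (contMDiffAt_extChartAt_symm_sphere hy))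

theorem injective_fderiv_sphereChartInv {ξ : Sphere2} {y : EuclideanSpace ℝ (Fin 2)}
    (hy : y ∈ (extChartAt (𝓡 2) ξ).target) :
    Function.Injective (fderiv ℝ (sphereChartInv ξ) y) := by
  have h1 : ContMDiff (𝓡 2) 𝓘(ℝ, Space3) ω (fun x : Sphere2 => (x : Space3)) :=
    contMDiff_coe_sphere
  have h2 := mfderiv_comp y (h1.contMDiffAt.mdifferentiableAt (by simp))
    ((contMDiffAt_extChartAt_symm_sphere hy).mdifferentiableAt (by simp))
  rw [mfderiv_eq_fderiv] at h2
  have h3 : (mfderiv 𝓘(ℝ, EuclideanSpace ℝ (Fin 2)) (𝓡 2) (extChartAt (𝓡 2) ξ).symm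
      y).IsInvertible := by
    have := isInvertible_mfderivWithin_extChartAt_symm hy
    rwa [ModelWithCorners.range_eq_univ, mfderivWithin_univ] at this
  have h4 := (injective_mvfderiv_subtypeVal_sphere (n := 2) ((extChartAt (𝓡 2) ξ).symm y)).comp
    h3.injective
  intro v w hvw
  refine h4 ?_
  have h5 := DFunLike.congr_fun h2 v
  have h6 := DFunLike.congr_fun h2 w
  exact h5.symm.trans (Eq.trans hvw h6)

/-- The coefficient of `-dT² + dX²`, in a chart. -/
def conf (m : ℝ) (x : Coord) : ℝ := 16 * m ^ 2 * (Real.exp (-rho (zval x)) / rho (zval x))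

/-- The square of the areal radius, in a chart. -/
def radSq (m : ℝ) (x : Coord) : ℝ := 4 * m ^ 2 * rho (zval x) ^ 2

theorem conf_pos {m : ℝ} (hm : 0 < m) {x : Coord} (hx : zval x < 1) : 0 < conf m x := by
  have := rho_pos hx
  unfold conf
  positivity

theorem radSq_pos {m : ℝ} (hm : 0 < m) {x : Coord} (hx : zval x < 1) : 0 < radSq m x := by
  have := rho_pos hx
  unfold radSq
  positivity

theorem contDiffAt_conf (m : ℝ) {x : Coord} (hx : zval x < 1) : ContDiffAt ℝ 2 (conf m) x := by
  have h1 := contDiffAt_rho_zval hx (n := 2)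
  exact contDiffAt_const.mul (h1.neg.exp.div h1 (rho_pos hx).ne')

theorem contDiffAt_radSq (m : ℝ) {x : Coord} (hx : zval x < 1) : ContDiffAt ℝ 2 (radSq m) x :=
  contDiffAt_const.mul ((contDiffAt_rho_zval hx (n := 2)).pow 2)

/-- The logarithmic differentials of `conf` and `radSq` are `dfac * d(T² - X²)` times `rho + 1` and
`-2` respectively, the origin of the coefficients in `IsGeodesicConormal`. -/
theorem fderiv_conf (m : ℝ) {x : Coord} (hx : zval x < 1) (v : Coord) :
    fderiv ℝ (conf m) x v = conf m x * (rho (zval x) + 1) * dfac x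
      * (2 * (x.1.1 * v.1.1 - x.1.2 * v.1.2)) := by
  obtain ⟨L, hL, hL'⟩ := hasFDerivAt_rho_zval hx
  have hρ := rho_pos hx
  have h1 : HasDerivAt (fun s : ℝ => 16 * m ^ 2 * (Real.exp (-s) / s))
      (16 * m ^ 2 * ((Real.exp (-rho (zval x)) * -1 * rho (zval x)
        - Real.exp (-rho (zval x)) * 1) / rho (zval x) ^ 2)) (rho (zval x)) :=
    (((hasDerivAt_id _).neg.exp).div (hasDerivAt_id _) hρ.ne').const_mul _
  have h2 : HasFDerivAt (conf m) _ x := HasDerivAt.comp_hasFDerivAt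
    (h₂ := fun s : ℝ => 16 * m ^ 2 * (Real.exp (-s) / s)) (f := fun x => rho (zval x)) x h1 hL
  rw [h2.fderiv]
  simp only [smul_apply, smul_eq_mul, hL', conf, dfac]
  field_simp
  ring

theorem fderiv_radSq (m : ℝ) {x : Coord} (hx : zval x < 1) (v : Coord) :
    fderiv ℝ (radSq m) x v = -radSq m x * (2 * dfac x)
      * (2 * (x.1.1 * v.1.1 - x.1.2 * v.1.2)) := by
  obtain ⟨L, hL, hL'⟩ := hasFDerivAt_rho_zval hx
  have h1 : HasFDerivAt (radSq m) _ x := (hL.pow 2).const_mul (4 * m ^ 2)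
  rw [h1.fderiv]
  simp only [smul_apply, smul_eq_mul, hL', radSq, nsmul_eq_mul]
  push_cast
  ring

/-- The coordinate `T` as a linear form. -/
def formT : Coord →L[ℝ] ℝ :=
  (ContinuousLinearMap.fst ℝ ℝ ℝ).comp
    (ContinuousLinearMap.fst ℝ (ℝ × ℝ) (EuclideanSpace ℝ (Fin 2)))

/-- The coordinate `X` as a linear form. -/
def formX : Coord →L[ℝ] ℝ :=
  (ContinuousLinearMap.snd ℝ ℝ ℝ).comp
    (ContinuousLinearMap.fst ℝ (ℝ × ℝ) (EuclideanSpace ℝ (Fin 2)))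

/-- The differential of a component of the angular position, in a chart. -/
def formAngle (ξ : Sphere2) (i : Fin 3) (x : Coord) : Coord →L[ℝ] ℝ :=
  (EuclideanSpace.proj (𝕜 := ℝ) i).comp ((fderiv ℝ (sphereChartInv ξ) x.2).comp
    (ContinuousLinearMap.snd ℝ (ℝ × ℝ) (EuclideanSpace ℝ (Fin 2))))

/-- The Kruskal metric in a chart. -/
def chartForm (m : ℝ) (ξ : Sphere2) (x : Coord) : Coord →L[ℝ] Coord →L[ℝ] ℝ :=
  (conf m x • formX).smulRight formX - (conf m x • formT).smulRight formT
    + ((radSq m x • formAngle ξ 0 x).smulRight (formAngle ξ 0 x)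
      + (radSq m x • formAngle ξ 1 x).smulRight (formAngle ξ 1 x)
      + (radSq m x • formAngle ξ 2 x).smulRight (formAngle ξ 2 x))

/-- The sphere part is assembled from the three Euclidean components of the angular position, which
makes smoothness a termwise matter; summed, they give the inner product. -/
theorem chartForm_apply (m : ℝ) (ξ : Sphere2) (x v w : Coord) :
    chartForm m ξ x v w = conf m x * (-(v.1.1 * w.1.1) + v.1.2 * w.1.2)
      + radSq m x * inner ℝ (fderiv ℝ (sphereChartInv ξ) x.2 v.2)
          (fderiv ℝ (sphereChartInv ξ) x.2 w.2) := by
  have h : chartForm m ξ x v w = conf m x * v.1.2 * w.1.2 - conf m x * v.1.1 * w.1.1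
      + (radSq m x * formAngle ξ 0 x v * formAngle ξ 0 x w
        + radSq m x * formAngle ξ 1 x v * formAngle ξ 1 x w
        + radSq m x * formAngle ξ 2 x v * formAngle ξ 2 x w) := rfl
  rw [h, PiLp.inner_apply, Fin.sum_univ_three]
  simp [formAngle]
  ring

theorem contDiffAt_formAngle {ξ : Sphere2} {x : Coord}
    (hx2 : x.2 ∈ (extChartAt (𝓡 2) ξ).target) (i : Fin 3) :
    ContDiffAt ℝ 2 (formAngle ξ i) x := by
  have h1 : ContDiffAt ℝ 2 (fun x : Coord => fderiv ℝ (sphereChartInv ξ) x.2) x :=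
    (((contDiffAt_sphereChartInv hx2).of_le le_top).fderiv_right (m := 2)
      (n := 3) (by norm_num)).comp x contDiffAt_snd
  exact contDiffAt_const.clm_comp (h1.clm_comp contDiffAt_const)

theorem contDiffAt_smul_smulRight {E : Type*} [NormedAddCommGroup E] [NormedSpace ℝ E]
    {c : E → ℝ} {l : E → E →L[ℝ] ℝ} {x : E} {n : WithTop ℕ∞} (hc : ContDiffAt ℝ n c x)
    (hl : ContDiffAt ℝ n l x) : ContDiffAt ℝ n (fun y => (c y • l y).smulRight (l y)) x :=
  (hc.smul hl).smulRight hl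

theorem contDiffAt_chartForm (m : ℝ) {ξ : Sphere2} {x : Coord} (hx : zval x < 1)
    (hx2 : x.2 ∈ (extChartAt (𝓡 2) ξ).target) : ContDiffAt ℝ 2 (chartForm m ξ) x := by
  have h1 (i : Fin 3) :=
    contDiffAt_smul_smulRight (contDiffAt_radSq m hx) (contDiffAt_formAngle hx2 i)
  have h2 (l : Coord →L[ℝ] ℝ) :=
    contDiffAt_smul_smulRight (contDiffAt_conf m hx) (contDiffAt_const (c := l))
  exact ((h2 formX).sub (h2 formT)).add (((h1 0).add (h1 1)).add (h1 2))

theorem fderiv_chartForm (m : ℝ) {ξ : Sphere2} {x : Coord} (hx : zval x < 1)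
    (hx2 : x.2 ∈ (extChartAt (𝓡 2) ξ).target) (v a b : Coord) :
    fderiv ℝ (chartForm m ξ) x v a b =
      fderiv ℝ (conf m) x v * (-(a.1.1 * b.1.1) + a.1.2 * b.1.2)
      + fderiv ℝ (radSq m) x v * inner ℝ (fderiv ℝ (sphereChartInv ξ) x.2 a.2)
          (fderiv ℝ (sphereChartInv ξ) x.2 b.2)
      + radSq m x * fderiv ℝ (fun y => (inner ℝ (fderiv ℝ (sphereChartInv ξ) y a.2)
          (fderiv ℝ (sphereChartInv ξ) y b.2) : ℝ)) x.2 v.2 := by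
  have hd := fderiv_clm_apply_apply ((contDiffAt_chartForm m hx hx2).differentiableAt two_ne_zero)
    (differentiableAt_const a) (differentiableAt_const b) v
  simp only [fderiv_fun_const, Pi.zero_apply, zero_apply, map_zero, add_zero] at hd
  rw [← hd]
  simp only [chartForm_apply]
  have h1 : DifferentiableAt ℝ (fderiv ℝ (sphereChartInv ξ)) x.2 :=
    (((contDiffAt_sphereChartInv hx2).of_le le_top).fderiv_right (m := 2)
      (n := 3) (by norm_num)).differentiableAt two_ne_zero
  have h2 : DifferentiableAt ℝ (fun y => (inner ℝ (fderiv ℝ (sphereChartInv ξ) y a.2)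
      (fderiv ℝ (sphereChartInv ξ) y b.2) : ℝ)) x.2 :=
    (h1.clm_apply (differentiableAt_const _)).inner ℝ (h1.clm_apply (differentiableAt_const _))
  have h3 := h2.hasFDerivAt.comp x (hasFDerivAt_snd (𝕜 := ℝ) (E := ℝ × ℝ))
  have hF := ((contDiffAt_conf m hx).differentiableAt two_ne_zero).hasFDerivAt
  have hR := ((contDiffAt_radSq m hx).differentiableAt two_ne_zero).hasFDerivAt
  have h4 := (hF.mul_const (-(a.1.1 * b.1.1) + a.1.2 * b.1.2)).add (hR.mul h3)
  refine (DFunLike.congr_fun h4.fderiv v).trans ?_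
  simp
  ring

theorem chartForm_symm (m : ℝ) (ξ : Sphere2) (x v w : Coord) :
    chartForm m ξ x v w = chartForm m ξ x w v := by
  rw [chartForm_apply, chartForm_apply, real_inner_comm]
  ring

theorem inner_fderiv_sphereChartInv_pos {ξ : Sphere2} {y : EuclideanSpace ℝ (Fin 2)}
    (hy : y ∈ (extChartAt (𝓡 2) ξ).target) {v : EuclideanSpace ℝ (Fin 2)} (hv : v ≠ 0) :
    0 < (inner ℝ (fderiv ℝ (sphereChartInv ξ) y v) (fderiv ℝ (sphereChartInv ξ) y v) : ℝ) := by
  rw [real_inner_self_eq_norm_sq]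
  have : fderiv ℝ (sphereChartInv ξ) y v ≠ 0 := fun h =>
    hv (injective_fderiv_sphereChartInv hy (by rw [h, map_zero]))
  positivity

theorem chartForm_nondegenerate {m : ℝ} (hm : 0 < m) {ξ : Sphere2} {x : Coord} (hx : zval x < 1)
    (hx2 : x.2 ∈ (extChartAt (𝓡 2) ξ).target) {v : Coord} (h : ∀ w, chartForm m ξ x v w = 0) :
    v = 0 := by
  have hF := (conf_pos hm hx).ne'
  have hR := (radSq_pos hm hx).ne'
  have h1 : v.1.1 = 0 := by simpa [chartForm_apply, hF] using h vecT
  have h2 : v.1.2 = 0 := by simpa [chartForm_apply, hF] using h vecX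
  have h3 := h (0, v.2)
  simp only [chartForm_apply, Prod.fst_zero, Prod.snd_zero, mul_zero, neg_zero, add_zero,
    zero_add, mul_eq_zero, hR, false_or] at h3
  have h4 : v.2 = 0 := by
    by_contra h4
    exact (inner_fderiv_sphereChartInv_pos hx2 h4).ne' h3
  ext1
  · exact Prod.ext h1 h2
  · exact h4

theorem zval_extChartAt (p q : Spacetime) :
    zval (extChartAt model p q) = T q ^ 2 - X q ^ 2 := rfl

theorem zval_lt_one_of_mem_target {p : Spacetime} {x : Coord}
    (hx : x ∈ (extChartAt model p).target) : zval x < 1 := by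
  rw [← (extChartAt model p).right_inv hx]
  exact ((extChartAt model p).symm x).2

theorem snd_mem_target {p q : Spacetime} (hq : q ∈ (extChartAt model p).source) :
    (extChartAt model p q).2 ∈ (extChartAt (𝓡 2) p.1.2).target ∧
      angle q = sphereChartInv p.1.2 (extChartAt model p q).2 := by
  have h1 : q.1.2 ∈ (extChartAt (𝓡 2) p.1.2).source := by
    rw [extChartAt_source] at hq ⊢
    have hq' : q.1 ∈ (chartAt (ModelProd (ℝ × ℝ) (EuclideanSpace ℝ (Fin 2))) p.1).source := by
      simpa [TopologicalSpace.Opens.chartAt_eq] using hq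
    rw [prodChartedSpace_chartAt] at hq'
    exact hq'.2
  refine ⟨(extChartAt (𝓡 2) p.1.2).map_source h1, ?_⟩
  exact congrArg Subtype.val ((extChartAt (𝓡 2) p.1.2).left_inv h1).symm

theorem dT_eq {p q : Spacetime} (hq : q ∈ (extChartAt model p).source) (v : TangentSpace model q) :
    dT q v = (mfderiv model 𝓘(ℝ, Coord) (extChartAt model p) q v : Coord).1.1 := by
  have h := differential_chartField hq (u := T) (U := fun x : Coord => x.1.1)
    (Eventually.of_forall fun _ => rfl) (hasFDerivAt_fst_fst _).differentiableAt v
  rw [(hasFDerivAt_fst_fst _).fderiv] at h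
  exact h

theorem dX_eq {p q : Spacetime} (hq : q ∈ (extChartAt model p).source) (v : TangentSpace model q) :
    dX q v = (mfderiv model 𝓘(ℝ, Coord) (extChartAt model p) q v : Coord).1.2 := by
  have h := differential_chartField hq (u := X) (U := fun x : Coord => x.1.2)
    (Eventually.of_forall fun _ => rfl) (hasFDerivAt_fst_snd _).differentiableAt v
  rw [(hasFDerivAt_fst_snd _).fderiv] at h
  exact h

theorem dAngle_eq {p q : Spacetime} (hq : q ∈ (extChartAt model p).source)
    (v : TangentSpace model q) :
    dAngle q v = fderiv ℝ (sphereChartInv p.1.2) (extChartAt model p q).2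
      (mfderiv model 𝓘(ℝ, Coord) (extChartAt model p) q v : Coord).2 := by
  have h1 : HasFDerivAt (sphereChartInv p.1.2 ∘ Prod.snd)
      ((fderiv ℝ (sphereChartInv p.1.2) (extChartAt model p q).2).comp
        (ContinuousLinearMap.snd ℝ (ℝ × ℝ) _)) (extChartAt model p q) :=
    ((contDiffAt_sphereChartInv (snd_mem_target hq).1).differentiableAt
      (by simp)).hasFDerivAt.comp _ hasFDerivAt_snd
  have h := mfderiv_apply_of_chart hq (u := angle)
    (U := sphereChartInv p.1.2 ∘ Prod.snd) ?_ h1.differentiableAt v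
  · rw [h1.fderiv] at h
    exact h
  · filter_upwards [(isOpen_extChartAt_source p).mem_nhds hq] with q' hq'
    exact (snd_mem_target hq').2

theorem isChartMetric_chartForm {m : ℝ} (hm : 0 < m) (p : Spacetime) :
    IsChartMetric model (metric m) p (chartForm m p.1.2) := by
  intro q hq v w
  have hρ := rho_pos (z := T q ^ 2 - X q ^ 2) q.2
  refine Eq.trans ?_ (chartForm_apply m _ _ _ _).symm
  rw [metric, dT_eq hq, dX_eq hq, dAngle_eq hq, dT_eq hq, dX_eq hq, dAngle_eq hq,
    arealRadius, scaledRadius_eq_rho, conf, radSq, zval_extChartAt]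
  have e1 : -(2 * m * rho (T q ^ 2 - X q ^ 2)) / (2 * m) = -rho (T q ^ 2 - X q ^ 2) := by
    field_simp
  have e2 : 32 * m ^ 3 / (2 * m * rho (T q ^ 2 - X q ^ 2)) * Real.exp (-rho (T q ^ 2 - X q ^ 2))
      = 16 * m ^ 2 * (Real.exp (-rho (T q ^ 2 - X q ^ 2)) / rho (T q ^ 2 - X q ^ 2)) := by
    field_simp
    norm_num
  rw [e1, e2]
  congr 2
  ring

/-- Specializes the parallel conormal to the warped product metric. Against `∂_T` and `∂_X` the
derivatives of the sphere metric drop out, so only those of `conf` and `radSq` enter. -/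
theorem exists_isGeodesicConormal {m : ℝ} (hm : 0 < m) {S : Set Spacetime}
    (hS : IsEmbeddedHypersurface model 3 S) (hspace : IsSpacelike model (metric m) S)
    (htime : IsTimeSymmetric model (metric m) S) (hΩ : ∀ q ∈ S, ¬(T q = 0 ∧ X q = 0))
    {p : Spacetime} (hp : p ∈ S) :
    ∃ (V : Set Coord) (f : Coord → ℝ) (n : Coord → Coord →L[ℝ] ℝ), IsGeodesicConormal f n V ∧
      V ⊆ (extChartAt model p).target ∧ extChartAt model p p ∈ V ∧
      ∀ x ∈ V, (extChartAt model p).symm x ∈ S ↔ f x = 0 := by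
  have htgt : ∀ x ∈ (extChartAt model p).target, x.2 ∈ (extChartAt (𝓡 2) p.1.2).target := by
    intro x hx
    have := (snd_mem_target ((extChartAt model p).map_target hx)).1
    rwa [(extChartAt model p).right_inv hx] at this
  obtain ⟨V, f, n, N, hV, hVt, hpV, hSf, hf, hn, hnf, hnN, hGN, hpar⟩ :=
    exists_parallel_conormal hS hspace htime hp (isChartMetric_chartForm hm p)
      (fun x hx => contDiffAt_chartForm m (zval_lt_one_of_mem_target hx) (htgt x hx))
      (fun x hx v => chartForm_nondegenerate hm (zval_lt_one_of_mem_target hx) (htgt x hx))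
      (fun x _ => chartForm_symm m _ x)
      (fun x hx => ⟨vecT, by
        simpa [chartForm_apply] using conf_pos hm (zval_lt_one_of_mem_target hx)⟩)
  refine ⟨V, f, n, ?_, hVt, hpV, hSf⟩
  have hz : ∀ x ∈ V, zval x < 1 := fun x hx => zval_lt_one_of_mem_target (hVt hx)
  have hT : ∀ x ∈ V, n x vecT = -(conf m x * (N x).1.1) := fun x hx => by
    simp [hGN x hx, chartForm_apply]
  have hX : ∀ x ∈ V, n x vecX = conf m x * (N x).1.2 := fun x hx => by
    simp [hGN x hx, chartForm_apply]
  have hy : ∀ x ∈ V, ∀ y, n x (0, y) = radSq m x *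
      inner ℝ (fderiv ℝ (sphereChartInv p.1.2) x.2 (N x).2)
        (fderiv ℝ (sphereChartInv p.1.2) x.2 y) := fun x hx y => by
    simp [hGN x hx, chartForm_apply]
  have htl : ∀ x ∈ V, (N x).1.2 ^ 2 < (N x).1.1 ^ 2 := by
    intro x hx
    have h1 := hnN x hx
    rw [hGN x hx, chartForm_apply] at h1
    have h2 : 0 ≤ radSq m x * inner ℝ (fderiv ℝ (sphereChartInv p.1.2) x.2 (N x).2)
        (fderiv ℝ (sphereChartInv p.1.2) x.2 (N x).2) :=
      mul_nonneg (radSq_pos hm (hz x hx)).le real_inner_self_nonneg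
    by_contra! h3
    have h4 := mul_nonneg (conf_pos hm (hz x hx)).le (sub_nonneg.2 h3)
    linarith
  refine ⟨hV, hz, hf, hn, hnf, fun x hx _ => ?_, fun x hx h0 v hv => ?_, fun x hx h0 v hv => ?_,
    fun x hx h0 hang y hy0 => ?_, fun x hx h0 h1 => ?_⟩
  · rw [hT x hx, hX x hx]
    have := mul_lt_mul_of_pos_left (htl x hx) (pow_pos (conf_pos hm (hz x hx)) 2)
    linarith
  · have hv2 := hv
    rw [coord_decomp, hy x hx, hT x hx, hX x hx] at hv2
    rw [hpar x hx h0 v hv, hT x hx, hX x hx]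
    simp only [fderiv_chartForm m (hz x hx) (htgt x (hVt hx)), fderiv_conf m (hz x hx),
      fderiv_radSq m (hz x hx), map_zero, inner_zero_right, fderiv_fun_const, Pi.zero_apply,
      zero_apply, mul_zero, add_zero, sub_zero, mul_one]
    rw [real_inner_comm] at hv2
    -- Tangency `n(v) = 0` trades the angular product of `N` and `v` for `n_T v_T + n_X v_X`; this
    -- yields the last term of the equation.
    linear_combination (-2 * dfac x * x.1.1) * hv2
  · have hv2 := hv
    rw [coord_decomp, hy x hx, hT x hx, hX x hx] at hv2
    rw [hpar x hx h0 v hv, hT x hx, hX x hx]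
    simp only [fderiv_chartForm m (hz x hx) (htgt x (hVt hx)), fderiv_conf m (hz x hx),
      fderiv_radSq m (hz x hx), map_zero, inner_zero_right, fderiv_fun_const, Pi.zero_apply,
      zero_apply, mul_zero, add_zero, mul_one]
    rw [real_inner_comm] at hv2
    linear_combination (2 * dfac x * x.1.2) * hv2
  · have hρ := rho_pos (hz x hx)
    have hN2 : (N x).2 = 0 := by
      by_contra hne
      have h1 := hang (N x).2
      rw [hy x hx] at h1
      exact (mul_pos (radSq_pos hm (hz x hx))
        (inner_fderiv_sphereChartInv_pos (htgt x (hVt hx)) hne)).ne' h1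
    have hpos := inner_fderiv_sphereChartInv_pos (htgt x (hVt hx)) hy0
    have hF := conf_pos hm (hz x hx)
    have hR := radSq_pos hm (hz x hx)
    have hd : 0 < dfac x := by
      unfold dfac
      positivity
    -- A purely radial-temporal normal leaves only `-1/2` times the derivative of `radSq` along `N`,
    -- times the squared length of `y`; rewriting `N` through `n` divides by `conf`.
    refine ⟨-(2 * radSq m x * dfac x / conf m x * inner ℝ
      (fderiv ℝ (sphereChartInv p.1.2) x.2 y) (fderiv ℝ (sphereChartInv p.1.2) x.2 y)),
      neg_ne_zero.2 (by positivity), ?_⟩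
    rw [hpar x hx h0 _ (hang y), hT x hx, hX x hx]
    simp only [fderiv_chartForm m (hz x hx) (htgt x (hVt hx)), fderiv_conf m (hz x hx),
      fderiv_radSq m (hz x hx), hN2, map_zero, inner_zero_right, inner_zero_left,
      fderiv_fun_const, Pi.zero_apply, zero_apply, Prod.fst_zero, Prod.snd_zero,
      mul_zero, add_zero, zero_mul, sub_zero, neg_zero, zero_add]
    field_simp
    ring
  · have hS' := (hSf x hx).2 h0
    refine hΩ _ hS' ?_
    have h2 := (extChartAt model p).right_inv (hVt hx)
    constructor
    · have : (extChartAt model p ((extChartAt model p).symm x)).1.1 = 0 := by rw [h2, h1]; rfl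
      exact this
    · have : (extChartAt model p ((extChartAt model p).symm x)).1.2 = 0 := by rw [h2, h1]; rfl
      exact this

end Kruskal

/-! ### Static slices, and confinement to one of them -/

namespace Kruskal

open Filter

/-- The hypersurface `T = c X`, a slice of constant Schwarzschild time if `|c| < 1`. -/
def staticSlice (c : ℝ) : Set Spacetime := {p | T p = c * X p}

theorem contMDiff_T : ContMDiff model 𝓘(ℝ, ℝ) ω T :=
  (contDiff_fst.contMDiff.comp contMDiff_fst).comp contMDiff_subtype_val

theorem contMDiff_X : ContMDiff model 𝓘(ℝ, ℝ) ω X :=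
  (contDiff_snd.contMDiff.comp contMDiff_fst).comp contMDiff_subtype_val

theorem differential_T_sub (c : ℝ) (q : Spacetime) (v : TangentSpace model q) :
    differential model (fun p => T p - c * X p) q v = dT q v - c * dX q v := by
  have hq := mem_extChartAt_source (I := model) q
  have hd : HasFDerivAt (fun x : Coord => x.1.1 - c * x.1.2) _ (extChartAt model q q) :=
    (hasFDerivAt_fst_fst _).sub ((hasFDerivAt_fst_snd _).const_mul c)
  have h := differential_chartField hq (u := fun p => T p - c * X p)
    (U := fun x : Coord => x.1.1 - c * x.1.2) (Eventually.of_forall fun _ => rfl)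
    hd.differentiableAt v
  rw [hd.fderiv] at h
  rw [h, dT_eq hq, dX_eq hq]
  rfl

theorem isEmbeddedHypersurface_staticSlice (c : ℝ) (k : WithTop ℕ∞) :
    IsEmbeddedHypersurface model k (staticSlice c) := by
  intro p _
  refine ⟨Set.univ, fun p => T p - c * X p, isOpen_univ, Set.mem_univ _, ?_, fun q _ h0 => ?_,
    fun q _ => sub_eq_zero.symm⟩
  · have h1 : ContDiff ℝ ω (fun a : ℝ × ℝ => a.1 - c * a.2) := by fun_prop
    have := h1.contMDiff.comp (contMDiff_T.prodMk_space contMDiff_X)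
    exact (this.of_le le_top).contMDiffOn
  · have hq := mem_extChartAt_source (I := model) q
    have h1 := differential_T_sub c q (chartField model q (fun _ => vecT) q)
    have h2 : differential model (fun p => T p - c * X p) q
        (chartField model q (fun _ => vecT) q) = 0 := by
      unfold differential
      rw [h0]
      rfl
    have h3 := mfderiv_extChartAt_chartField (I := model) hq (fun _ => vecT)
    rw [h2, dT_eq hq, dX_eq hq, h3] at h1
    simp at h1

theorem isSpacelike_staticSlice {m : ℝ} (hm : 0 < m) {c : ℝ} (hc : c ^ 2 < 1) :
    IsSpacelike model (metric m) (staticSlice c) := by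
  intro q hqS v hv hv0
  have hC : ContMDiff model 𝓘(ℝ, ℝ) 1 (fun p => T p - c * X p) := by
    have h1 : ContDiff ℝ ω (fun a : ℝ × ℝ => a.1 - c * a.2) := by fun_prop
    exact (h1.contMDiff.comp (contMDiff_T.prodMk_space contMDiff_X)).of_le le_top
  have h0 := hv _ hC.contMDiffAt (by
    filter_upwards [self_mem_nhdsWithin] with p hp
    exact sub_eq_zero.2 hp)
  rw [differential_T_sub] at h0
  have hT : dT q v = c * dX q v := sub_eq_zero.1 h0
  have hρ : 0 < arealRadius m q := (arealRadius_spec m hm q).1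
  have hne : dX q v ≠ 0 ∨ dAngle q v ≠ 0 := by
    by_contra! hcon
    obtain ⟨hX, hA⟩ := hcon
    rw [hX, mul_zero] at hT
    have hq := mem_extChartAt_source (I := model) q
    rw [dT_eq hq] at hT
    rw [dX_eq hq] at hX
    rw [dAngle_eq hq] at hA
    apply hv0
    have h2 := injective_fderiv_sphereChartInv (snd_mem_target hq).1 (hA.trans (map_zero _).symm)
    refine (isInvertible_mfderiv_extChartAt hq).injective (Eq.trans ?_ (map_zero _).symm)
    exact Prod.ext (Prod.ext hT hX) h2
  have hF : 0 < 32 * m ^ 3 / arealRadius m q * Real.exp (-arealRadius m q / (2 * m)) := by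
    positivity
  -- On the slice `dT = c dX`, so both remaining terms of the metric are nonnegative and at least
  -- one is positive.
  have e : metric m q v v = 32 * m ^ 3 / arealRadius m q *
      Real.exp (-arealRadius m q / (2 * m)) * ((1 - c ^ 2) * dX q v ^ 2)
      + arealRadius m q ^ 2 * ‖dAngle q v‖ ^ 2 := by
    rw [metric, hT, real_inner_self_eq_norm_sq]
    ring
  rw [e]
  have h1 : 0 < 1 - c ^ 2 := by linarith
  rcases hne with h | h
  · have := norm_nonneg (dAngle q v)
    positivity
  · have := norm_pos_iff.2 h
    positivity

/-- The points of the slice `T = c X`. -/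
def slicePoint {c : ℝ} (hc : c ^ 2 < 1) (a : ℝ × Sphere2) : Spacetime :=
  ⟨((c * a.1, a.1), a.2), by
    change (c * a.1) ^ 2 - a.1 ^ 2 < 1
    nlinarith [sq_nonneg a.1]⟩

theorem range_slicePoint {c : ℝ} (hc : c ^ 2 < 1) : Set.range (slicePoint hc) = staticSlice c := by
  ext p
  constructor
  · rintro ⟨a, rfl⟩
    rfl
  · intro hp
    refine ⟨(X p, p.1.2), Subtype.ext (Prod.ext (Prod.ext ?_ rfl) rfl)⟩
    exact hp.symm

theorem isConnected_staticSlice {c : ℝ} (hc : c ^ 2 < 1) : IsConnected (staticSlice c) := by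
  have hsphere : IsConnected (Metric.sphere (0 : Space3) 1) := by
    refine isConnected_sphere ?_ 0 zero_le_one
    rw [← Module.finrank_eq_rank, finrank_euclideanSpace_fin]
    norm_num
  have : ConnectedSpace Sphere2 := isConnected_iff_connectedSpace.1 hsphere
  rw [← range_slicePoint hc]
  refine isConnected_range (Continuous.subtype_mk ?_ _)
  fun_prop

theorem mem_bifurcationSphere {p : Spacetime} (hT : T p = 0) (hX : X p = 0) :
    p ∈ bifurcationSphere := by
  constructor
  · simp [futureHorizon, hT, hX]
  · simp [pastHorizon, hT, hX]

/-- A connected spacelike time-symmetric hypersurface that misses the bifurcation sphere lies in a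
slice of constant Schwarzschild time. -/
theorem exists_subset_staticSlice {m : ℝ} (hm : 0 < m) {S : Set Spacetime}
    (hS : IsEmbeddedHypersurface model 3 S) (hspace : IsSpacelike model (metric m) S)
    (hconn : IsConnected S) (htime : IsTimeSymmetric model (metric m) S)
    (hΩ : ∀ q ∈ S, ¬(T q = 0 ∧ X q = 0)) : ∃ c : ℝ, c ^ 2 < 1 ∧ S ⊆ staticSlice c := by
  have hloc : ∀ p ∈ S, T p ^ 2 < X p ^ 2 ∧ ∀ᶠ q in 𝓝[S] p, T q / X q = T p / X p := by
    intro p hp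
    obtain ⟨V, f, n, h, hVt, hpV, hSf⟩ := exists_isGeodesicConormal hm hS hspace htime hΩ hp
    have hps := mem_extChartAt_source (I := model) p
    have h0 : f (extChartAt model p p) = 0 := by
      rw [← hSf _ hpV, (extChartAt model p).left_inv hps]
      exact hp
    refine ⟨h.sq_lt_sq hpV h0, ?_⟩
    rw [eventually_nhdsWithin_iff]
    have hcont := continuousAt_extChartAt (I := model) p
    filter_upwards [hcont.eventually (h.eventually_div_eq hpV h0),
      hcont.eventually (h.isOpen.mem_nhds hpV),
      (isOpen_extChartAt_source p).mem_nhds hps] with q h1 h2 h3 hq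
    refine h1 ((hSf _ h2).1 ?_)
    rwa [(extChartAt model p).left_inv h3]
  have hX : ∀ p ∈ S, X p ≠ 0 := by
    intro p hp h0
    have := (hloc p hp).1
    rw [h0] at this
    nlinarith [sq_nonneg (T p)]
  obtain ⟨p₀, hp₀⟩ := hconn.nonempty
  have : PreconnectedSpace S := isPreconnected_iff_preconnectedSpace.1 hconn.isPreconnected
  -- Local constancy in charts becomes global through connectedness of `S`; the constant has square
  -- less than one because `T² < X²`.
  have hlc : IsLocallyConstant (fun q : S => T q / X q) := by
    rw [IsLocallyConstant.iff_eventually_eq]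
    intro q
    have := (hloc q q.2).2
    rw [nhdsWithin_eq_map_subtype_coe q.2] at this
    exact this
  refine ⟨T p₀ / X p₀, ?_, fun q hq => ?_⟩
  · rw [div_pow, div_lt_one (by have := hX p₀ hp₀; positivity)]
    exact (hloc p₀ hp₀).1
  · have := hlc.apply_eq_of_preconnectedSpace ⟨q, hq⟩ ⟨p₀, hp₀⟩
    exact (div_eq_iff (hX q hq)).1 this

end Kruskal

/-! ### Regularity and conclusion -/

theorem IsEmbeddedHypersurface.of_le {E H M : Type*} [NormedAddCommGroup E] [NormedSpace ℝ E]
    [TopologicalSpace H] {I : ModelWithCorners ℝ E H} [TopologicalSpace M] [ChartedSpace H M]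
    {k l : WithTop ℕ∞} {S : Set M} (h : IsEmbeddedHypersurface I k S) (hl : l ≤ k) :
    IsEmbeddedHypersurface I l S := by
  intro p hp
  obtain ⟨W, f, hW, hpW, hf, hdf, hS⟩ := h p hp
  exact ⟨W, f, hW, hpW, hf.of_le hl, hdf, hS⟩

/-- The orders are integers, `∞` and `ω`, so `k > 2` gives `C^3`. Then `n` is `C^2`, as is the boost
function, whose symmetric Hessian underlies the closedness argument. -/
theorem three_le_of_two_lt {k : WithTop ℕ∞} (hk : 2 < k) : 3 ≤ k := by
  induction k with
  | top => exact le_top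
  | coe k =>
    have h2 : (2 : ℕ∞) < k := WithTop.coe_lt_coe.1 hk
    have h3 : (3 : ℕ∞) ≤ k := by
      have := Order.add_one_le_of_lt h2
      rwa [show (2 : ℕ∞) + 1 = 3 by norm_num] at this
    exact WithTop.coe_le_coe.2 h3

end

theorem corollary1 (m : ℝ) (hm : 0 < m) (k : WithTop ℕ∞) (hk : 2 < k)
    (S : Set Kruskal.Spacetime)
    (hS : IsEmbeddedHypersurface Kruskal.model k S)
    (hspacelike : IsSpacelike Kruskal.model (Kruskal.metric m) S)
    (hconnected : IsConnected S)
    (hsymmetric : IsTimeSymmetric Kruskal.model (Kruskal.metric m) S)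
    (hinextensible : IsInextensible Kruskal.model (Kruskal.metric m) k S) :
    (S ∩ Kruskal.bifurcationSphere).Nonempty := by
  by_contra hempty
  have hΩ : ∀ q ∈ S, ¬(Kruskal.T q = 0 ∧ Kruskal.X q = 0) := fun q hq h =>
    hempty ⟨q, hq, Kruskal.mem_bifurcationSphere h.1 h.2⟩
  obtain ⟨c, hc, hSc⟩ := Kruskal.exists_subset_staticSlice hm (hS.of_le (three_le_of_two_lt hk))
    hspacelike hconnected hsymmetric hΩ
  refine hinextensible ⟨Kruskal.staticSlice c, Kruskal.isEmbeddedHypersurface_staticSlice c k,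
    Kruskal.isSpacelike_staticSlice hm hc, Kruskal.isConnected_staticSlice hc, hSc, fun hle => ?_⟩
  obtain ⟨p, hp⟩ := hconnected.nonempty
  -- The slice contains every point with `T = X = 0`, while `S` contains none, so the inclusion is
  -- proper; the angle is borrowed from any point of `S`.
  have hmem : Kruskal.slicePoint hc (0, p.1.2) ∈ Kruskal.staticSlice c := by
    rw [← Kruskal.range_slicePoint hc]
    exact ⟨_, rfl⟩
  exact hΩ _ (hle hmem) ⟨mul_zero c, rfl⟩
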